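/- Let $\mathcal{L}_{\sin}$ be the first-order signature $\{<,+,0,1,\sin,(\lambda_q)_{q\in\mathbb{Q}}\}$ with equality, interpreted in $\mathbb{R}$ in the usual way, with $\lambda_q$ interpreted as $x\mapsto qx$. For $K\ge 1$, an $\exists^K\forall^K\exists^K\forall^K$ $\sin$-PA sentence is an expression $$\exists x_1\in\mathbb{Z}^K\ \forall x_2\in\mathbb{Z}^K\ \exists x_3\in\mathbb{Z}^K\ \forall x_4\in\mathbb{Z}^K\ \ \Phi(x_1,x_2,x_3,x_4),$$ where $\Phi$ is a quantifier-free $\mathcal{L}_{\sin}$-formula all of whose variables are among $x_1,\dots,x_4$; it is true if it holds when terms are evaluated in $\mathbb{R}$ and all quantified variables range over the integers. Theorem A. For $K=3388$, the set of true $\exists^K\forall^K\exists^K\forall^K$ $\sin$-PA sentences is undecidable: no algorithm decides, given (the Gödel number of) a sentence, whether it belongs to this set. -/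

import Mathlib

namespace SinPA

/-- The function symbols `0, 1` (constants), `sin` and `λ_q` for rational `q` (unary),
and `+` (binary). -/
inductive Func : ℕ → Type
  | zero : Func 0
  | one : Func 0
  | sin : Func 1
  | smul (q : ℚ) : Func 1
  | add : Func 2

/-- The only relation symbol besides equality is the binary symbol `<`. -/
inductive Rel : ℕ → Type
  | lt : Rel 2

/-- The signature `{<, +, 0, 1, sin, (λ_q)_{q ∈ ℚ}}`. -/
def lang : FirstOrder.Language.{0, 0} := ⟨Func, Rel⟩

/-- The real numbers as a structure for this signature, `λ_q` being `x ↦ q x`. -/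
noncomputable instance realStructure : lang.Structure ℝ where
  funMap {_} f v := match f, v with
    | Func.zero, _ => 0
    | Func.one, _ => 1
    | Func.sin, v => Real.sin (v 0)
    | Func.smul q, v => (q : ℝ) * v 0
    | Func.add, v => v 0 + v 1
  RelMap {_} r v := match r, v with
    | Rel.lt, v => v 0 < v 1

/-- Formulas of the signature, with free variables indexed by `Fin n`. -/
abbrev Form (n : ℕ) : Type := lang.BoundedFormula Empty n

/-- Terms of the signature, with variables indexed by `Fin n`. -/
abbrev Trm (n : ℕ) : Type := lang.Term (Empty ⊕ Fin n)

/-- The real value of a term when its variables take the integer values `x`. -/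
noncomputable def Trm.val {n : ℕ} (t : Trm n) (x : Fin n → ℤ) : ℝ :=
  t.realize (Sum.elim Empty.elim fun i => (x i : ℝ))

/-- Satisfaction of a formula by a tuple of integers: terms are evaluated in `ℝ`, while every
quantifier ranges over `ℤ`. -/
def Form.HoldsInt : {n : ℕ} → Form n → (Fin n → ℤ) → Prop
  | _, .falsum, _ => False
  | _, .equal t u, x => Trm.val t x = Trm.val u x
  | _, .rel r ts, x => FirstOrder.Language.Structure.RelMap r fun i => Trm.val (ts i) x
  | _, .imp φ ψ, x => Form.HoldsInt φ x → Form.HoldsInt ψ x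
  | _, .all φ, x => ∀ z : ℤ, Form.HoldsInt φ (Fin.snoc x z)

/-- A block of `k` existential quantifiers in front of a formula. -/
def exBlock {n : ℕ} : (k : ℕ) → Form (n + k) → Form n
  | 0, φ => φ
  | k + 1, φ => exBlock k φ.ex

/-- A block of `k` universal quantifiers in front of a formula. -/
def allBlock {n : ℕ} : (k : ℕ) → Form (n + k) → Form n
  | 0, φ => φ
  | k + 1, φ => allBlock k φ.all

/-- The sentences `∃^K ∀^K ∃^K ∀^K φ` with `φ` quantifier-free. -/
def IsEAEA (K : ℕ) (Φ : Form 0) : Prop :=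
  ∃ φ : Form (0 + K + K + K + K),
    φ.IsQF ∧ Φ = exBlock K (allBlock K (exBlock K (allBlock K φ)))

/-- A sentence is true if it holds with all quantifiers ranging over the integers. -/
def IsTrue (Φ : Form 0) : Prop := Form.HoldsInt Φ Fin.elim0

/-- The code of a term, a natural number. -/
def Trm.code {n : ℕ} : Trm n → ℕ
  | .var (.inl e) => e.elim
  | .var (.inr i) => Nat.pair 0 i
  | .func Func.zero _ => Nat.pair 1 0
  | .func Func.one _ => Nat.pair 2 0
  | .func Func.sin ts => Nat.pair 3 (Trm.code (ts 0))
  | .func (Func.smul q) ts =>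
      Nat.pair 4 (Nat.pair (Nat.pair (Encodable.encode q.num) q.den) (Trm.code (ts 0)))
  | .func Func.add ts => Nat.pair 5 (Nat.pair (Trm.code (ts 0)) (Trm.code (ts 1)))

/-- The code (Gödel number) of a formula. -/
def Form.code : {n : ℕ} → Form n → ℕ
  | _, .falsum => Nat.pair 0 0
  | _, .equal t u => Nat.pair 1 (Nat.pair (Trm.code t) (Trm.code u))
  | _, .rel Rel.lt ts => Nat.pair 2 (Nat.pair (Trm.code (ts 0)) (Trm.code (ts 1)))
  | _, .imp φ ψ => Nat.pair 3 (Nat.pair (Form.code φ) (Form.code ψ))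
  | _, .all φ => Nat.pair 4 (Form.code φ)

/-- Different terms have different codes. -/
theorem Trm.code_injective {n : ℕ} : Function.Injective (Trm.code (n := n)) := by
  intro t
  induction t with
  | var v =>
    intro u h
    rcases v with e | i
    · exact e.elim
    · rcases u with (e | j) | ⟨f, us⟩
      · exact e.elim
      · simp [Trm.code, Fin.ext_iff] at h ⊢
        exact h
      · cases f <;> simp [Trm.code] at h
  | func f ts ih =>
    intro u h
    rcases u with (e | j) | ⟨g, us⟩
    · exact e.elim
    · cases f <;> simp [Trm.code] at h
    · cases f <;> cases g <;> simp [Trm.code] at h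
      · congr 1
        exact Subsingleton.elim (α := Fin 0 → Trm n) _ _
      · congr 1
        exact Subsingleton.elim (α := Fin 0 → Trm n) _ _
      · congr 1
        funext i
        obtain rfl : i = 0 := Subsingleton.elim (α := Fin 1) _ _
        exact ih _ h
      · obtain ⟨⟨h1, h2⟩, h3⟩ := h
        obtain rfl := Rat.ext h1 h2
        congr 1
        funext i
        obtain rfl : i = 0 := Subsingleton.elim (α := Fin 1) _ _
        exact ih _ h3
      · congr 1
        funext i
        revert i
        exact Fin.forall_fin_two.2 ⟨ih _ h.1, ih _ h.2⟩

/-- Different formulas have different codes. -/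
theorem Form.code_injective {n : ℕ} : Function.Injective (Form.code (n := n)) := by
  intro φ
  induction φ with
  | falsum =>
    intro ψ h
    cases ψ with
    | falsum => rfl
    | rel r ts => cases r; simp [Form.code] at h
    | _ => simp [Form.code] at h
  | equal t u =>
    intro ψ h
    cases ψ with
    | equal t' u' =>
      simp [Form.code] at h
      rw [Trm.code_injective h.1, Trm.code_injective h.2]
    | rel r ts => cases r; simp [Form.code] at h
    | _ => simp [Form.code] at h
  | rel r ts =>
    intro ψ h
    cases r
    cases ψ with
    | rel r' ts' =>
      cases r'
      simp [Form.code] at h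
      congr 1
      funext i
      revert i
      exact Fin.forall_fin_two.2 ⟨Trm.code_injective h.1, Trm.code_injective h.2⟩
    | _ => simp [Form.code] at h
  | imp φ₁ φ₂ ih₁ ih₂ =>
    intro ψ h
    cases ψ with
    | imp ψ₁ ψ₂ =>
      simp [Form.code] at h
      rw [ih₁ h.1, ih₂ h.2]
    | rel r ts => cases r; simp [Form.code] at h
    | _ => simp [Form.code] at h
  | all φ ih =>
    intro ψ h
    cases ψ with
    | all ψ =>
      simp [Form.code] at h
      rw [ih h]
    | rel r ts => cases r; simp [Form.code] at h
    | _ => simp [Form.code] at h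

/-- A set of sentences is decidable if some algorithm, on input a natural number, decides
whether that number is the code of a sentence in the set. -/
def DecidableSet (S : Set (Form 0)) : Prop :=
  ComputablePred fun m : ℕ => ∃ Φ ∈ S, Form.code Φ = m

end SinPA

/-! ### Quantifier blocks, Gödel numbers and definability. -/

namespace SinPA

open FirstOrder.Language

/-! ### Blocks of quantifiers -/

/-! The halting problem is reduced to truth of these sentences. A halting computation has a finite
derivation: a finite set of facts "code `e` on input `x` gives `y`", each an axiom or inferred by a
rule from facts in the set. A rank that drops from conclusion to premises excludes circular
derivations. The rules must be linear, so the squares needed for `Nat.pair` are derived facts too,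
via `a ^ 2 = (a - 1) ^ 2 + 2 * a - 1`. A fact is thus a vector in `ℤ^4`; soundness is
`IsClosedUnder.holds`, completeness is `provable_evalFact`.

A finite set of integer vectors is coded by a few integers (`exists_code`). For generic `θ`, the map
`(s, b) ↦ b + ∑ sin (s_j + θ_j)` is injective modulo `2π`, so `c` can be placed where a given pair
`(s, b)` has the strictly best score `sin (c - b - ∑ sin (s_j + θ_j))` up to any bound. Smaller and
smaller open sets for `(θ, c)` make the listed vectors the winners at growing scales `|b'| ≤ |n|`. A
second real `c'` singles out the scales: they are the integers `n` that approximate `c'` better than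
all earlier ones. Only finitely many strict inequalities are involved, and integers are dense modulo
`2π`, so integer parameters suffice.

Membership in a coded set is an `∃∀` condition: there are `b` and `n` that no competitor refutes.
"There is a code containing the goal such that every coded fact is an axiom or has coded premises"
therefore becomes `∃∀∃∀`. The second block holds a candidate fact and a competitor against the goal,
the third the premises or a competitor refuting the candidate, the fourth a competitor against the
premises. -/

theorem holdsInt_ex {n : ℕ} (φ : Form (n + 1)) (x : Fin n → ℤ) :
    Form.HoldsInt φ.ex x ↔ ∃ z : ℤ, Form.HoldsInt φ (Fin.snoc x z) := by
  change ((∀ z : ℤ, Form.HoldsInt φ (Fin.snoc x z) → False) → False) ↔ _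
  simp only [imp_false, not_forall, not_not]

theorem holdsInt_all {n : ℕ} (φ : Form (n + 1)) (x : Fin n → ℤ) :
    Form.HoldsInt φ.all x ↔ ∀ z : ℤ, Form.HoldsInt φ (Fin.snoc x z) := Iff.rfl

theorem forall_fin_succ_iff_snoc {k : ℕ} (P : (Fin (k + 1) → ℤ) → Prop) :
    (∀ y, P y) ↔ ∀ (y : Fin k → ℤ) (z : ℤ), P (Fin.snoc y z) := by
  refine ⟨fun h y z => h _, fun h y => ?_⟩
  rw [← Fin.snoc_init_self y]
  exact h _ _

theorem exists_fin_succ_iff_snoc {k : ℕ} (P : (Fin (k + 1) → ℤ) → Prop) :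
    (∃ y, P y) ↔ ∃ (y : Fin k → ℤ) (z : ℤ), P (Fin.snoc y z) := by
  have h := forall_fin_succ_iff_snoc fun y => ¬ P y
  simpa only [not_exists, not_forall, not_not] using not_congr h

theorem holdsInt_exBlock {n : ℕ} (k : ℕ) (φ : Form (n + k)) (x : Fin n → ℤ) :
    Form.HoldsInt (exBlock k φ) x ↔ ∃ y : Fin k → ℤ, Form.HoldsInt φ (Fin.append x y) := by
  induction k with
  | zero =>
    simp only [exBlock]
    refine ⟨fun h => ⟨Fin.elim0, by rwa [Fin.append_elim0]⟩, fun ⟨y, h⟩ => ?_⟩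
    rwa [Subsingleton.elim y Fin.elim0, Fin.append_elim0] at h
  | succ k ih =>
    rw [exBlock, ih, exists_fin_succ_iff_snoc]
    refine exists_congr fun y => ?_
    rw [holdsInt_ex]
    refine exists_congr fun z => ?_
    rw [Fin.append_snoc]

theorem holdsInt_allBlock {n : ℕ} (k : ℕ) (φ : Form (n + k)) (x : Fin n → ℤ) :
    Form.HoldsInt (allBlock k φ) x ↔ ∀ y : Fin k → ℤ, Form.HoldsInt φ (Fin.append x y) := by
  induction k with
  | zero =>
    simp only [allBlock]
    refine ⟨fun h y => ?_, fun h => ?_⟩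
    · rwa [Subsingleton.elim y Fin.elim0, Fin.append_elim0]
    · have := h Fin.elim0
      rwa [Fin.append_elim0] at this
  | succ k ih =>
    rw [allBlock, ih, forall_fin_succ_iff_snoc]
    refine forall_congr' fun y => ?_
    rw [holdsInt_all]
    refine forall_congr' fun z => ?_
    rw [Fin.append_snoc]

/-! ### Computability of Gödel numbers. -/

theorem computable_pair_nat {f g : ℕ → ℕ} (hf : Computable f) (hg : Computable g) :
    Computable fun n => Nat.pair (f n) (g n) :=
  Primrec₂.natPair.to_comp.comp hf hg

theorem computable_code_imp {k : ℕ} {φ ψ : ℕ → Form k} (hφ : Computable fun n => (φ n).code)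
    (hψ : Computable fun n => (ψ n).code) :
    Computable fun n => Form.code ((φ n).imp (ψ n)) :=
  computable_pair_nat (Computable.const 3) (computable_pair_nat hφ hψ)

theorem computable_code_all {k : ℕ} {φ : ℕ → Form (k + 1)} (hφ : Computable fun n => (φ n).code) :
    Computable fun n => Form.code ((φ n).all) :=
  computable_pair_nat (Computable.const 4) hφ

theorem computable_code_falsum {k : ℕ} :
    Computable fun _ : ℕ => Form.code (BoundedFormula.falsum : Form k) :=
  Computable.const _

theorem computable_code_ex {k : ℕ} {φ : ℕ → Form (k + 1)} (hφ : Computable fun n => (φ n).code) :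
    Computable fun n => Form.code ((φ n).ex) :=
  computable_code_imp (computable_code_all (computable_code_imp hφ computable_code_falsum))
    computable_code_falsum

theorem computable_code_exBlock {n : ℕ} (k : ℕ) {φ : ℕ → Form (n + k)}
    (hφ : Computable fun i => (φ i).code) : Computable fun i => (exBlock k (φ i)).code := by
  induction k with
  | zero => exact hφ
  | succ k ih => exact ih (φ := fun i => (φ i).ex) (computable_code_ex hφ)

theorem computable_code_allBlock {n : ℕ} (k : ℕ) {φ : ℕ → Form (n + k)}
    (hφ : Computable fun i => (φ i).code) : Computable fun i => (allBlock k (φ i)).code := by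
  induction k with
  | zero => exact hφ
  | succ k ih => exact ih (φ := fun i => (φ i).all) (computable_code_all hφ)

/-! ### Assignments of four blocks of variables -/

/-- A block of integer variables, read as eleven rows of six integers. -/
abbrev Block : Type := Fin 11 → Fin 6 → ℤ

/-- The position of an entry of a block among its variables. -/
def entry (K : ℕ) (hK : 66 ≤ K) (i : Fin 11) (j : Fin 6) : Fin K := ⟨6 * i + j, by omega⟩

theorem exists_entry_eq {K : ℕ} (hK : 66 ≤ K) (v : Block) :
    ∃ y : Fin K → ℤ, (fun i j => y (entry K hK i j)) = v := by
  have hinj : Function.Injective fun p : Fin 11 × Fin 6 => entry K hK p.1 p.2 := by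
    rintro ⟨i, j⟩ ⟨i', j'⟩ h
    simp only [entry, Fin.mk.injEq] at h
    ext <;> simp only <;> omega
  obtain ⟨y, hy⟩ := hinj.surjective_comp_right (fun p : Fin 11 × Fin 6 => v p.1 p.2)
  exact ⟨y, funext fun i => funext fun j => congrFun hy (i, j)⟩

/-- The variable of the formula that stands for an entry of one of the four blocks. -/
def varIdx (K : ℕ) (hK : 66 ≤ K) (a : Fin 4) (i : Fin 11) (j : Fin 6) : Fin (0 + K + K + K + K) :=
  match a with
  | 0 => Fin.castAdd K (Fin.castAdd K (Fin.castAdd K (Fin.natAdd 0 (entry K hK i j))))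
  | 1 => Fin.castAdd K (Fin.castAdd K (Fin.natAdd (0 + K) (entry K hK i j)))
  | 2 => Fin.castAdd K (Fin.natAdd (0 + K + K) (entry K hK i j))
  | 3 => Fin.natAdd (0 + K + K + K) (entry K hK i j)

/-- The four blocks of values given by an assignment. -/
def readBlocks (K : ℕ) (hK : 66 ≤ K) (x : Fin (0 + K + K + K + K) → ℤ) : Fin 4 → Block :=
  fun a i j => x (varIdx K hK a i j)

theorem readBlocks_append {K : ℕ} (hK : 66 ≤ K) (y₁ y₂ y₃ y₄ : Fin K → ℤ) :
    readBlocks K hK (Fin.append (Fin.append (Fin.append (Fin.append Fin.elim0 y₁) y₂) y₃) y₄) =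
      ![fun i j => y₁ (entry K hK i j), fun i j => y₂ (entry K hK i j),
        fun i j => y₃ (entry K hK i j), fun i j => y₄ (entry K hK i j)] := by
  funext a i j
  fin_cases a
  · simp only [readBlocks, varIdx, Fin.append_left, Fin.append_right]; rfl
  · simp only [readBlocks, varIdx, Fin.append_left, Fin.append_right]; rfl
  · simp only [readBlocks, varIdx, Fin.append_left, Fin.append_right]; rfl
  · simp only [readBlocks, varIdx, Fin.append_right]; rfl

/-! ### Definable families of functions and predicates -/

/-- The functions `T n` are the values of terms whose codes depend computably on `n`. -/
def IsTerm (T : ℕ → (Fin 4 → Block) → ℝ) : Prop :=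
  ∃ t : ℕ → Trm (0 + 3388 + 3388 + 3388 + 3388), Computable (fun n => (t n).code) ∧
    ∀ n x, (t n).val x = T n (readBlocks 3388 (by norm_num) x)

/-- The integer functions `T n` are the values of terms whose codes depend computably on `n`. -/
def IsIntTerm (T : ℕ → (Fin 4 → Block) → ℤ) : Prop := IsTerm fun n v => (T n v : ℝ)

/-- The predicates `R n` are defined by quantifier-free formulas whose codes depend computably
on `n`. -/
def IsQFForm (R : ℕ → (Fin 4 → Block) → Prop) : Prop :=
  ∃ φ : ℕ → Form (0 + 3388 + 3388 + 3388 + 3388), (∀ n, (φ n).IsQF) ∧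
    Computable (fun n => (φ n).code) ∧
    ∀ n x, (φ n).HoldsInt x ↔ R n (readBlocks 3388 (by norm_num) x)

theorem IsIntTerm.var (a : Fin 4) (i : Fin 11) (j : Fin 6) : IsIntTerm fun _ v => v a i j :=
  ⟨fun _ => .var (.inr (varIdx _ _ a i j)), Computable.const _, fun _ _ => rfl⟩

theorem IsTerm.add {T U} (hT : IsTerm T) (hU : IsTerm U) : IsTerm fun n v => T n v + U n v := by
  obtain ⟨t, ht, ht'⟩ := hT
  obtain ⟨u, hu, hu'⟩ := hU
  refine ⟨fun n => .func Func.add ![t n, u n], ?_, fun n x => ?_⟩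
  · exact computable_pair_nat (Computable.const 5) (computable_pair_nat ht hu)
  · change (t n).val x + (u n).val x = T n _ + U n _
    rw [ht', hu']

theorem IsTerm.sin {T} (hT : IsTerm T) : IsTerm fun n v => Real.sin (T n v) := by
  obtain ⟨t, ht, ht'⟩ := hT
  refine ⟨fun n => .func Func.sin ![t n], ?_, fun n x => ?_⟩
  · exact computable_pair_nat (Computable.const 3) ht
  · change Real.sin ((t n).val x) = Real.sin (T n _)
    rw [ht']

theorem IsTerm.smul {T} (q : ℚ) (hT : IsTerm T) : IsTerm fun n v => (q : ℝ) * T n v := by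
  obtain ⟨t, ht, ht'⟩ := hT
  refine ⟨fun n => .func (Func.smul q) ![t n], ?_, fun n x => ?_⟩
  · exact computable_pair_nat (Computable.const 4) (computable_pair_nat (Computable.const _) ht)
  · change (q : ℝ) * (t n).val x = q * T n _
    rw [ht']

theorem IsTerm.one : IsTerm fun _ _ => 1 :=
  ⟨fun _ => .func Func.one ![], Computable.const _, fun _ _ => rfl⟩

/-- The input `n` enters only through the scalar symbol `λ_n`, applied to `1`; the shape of the
sentence stays fixed. -/
theorem IsTerm.param : IsTerm fun n _ => (n : ℝ) := by
  refine ⟨fun n => .func (Func.smul n) ![.func Func.one ![]], ?_, fun n x => ?_⟩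
  · refine computable_pair_nat (Computable.const 4) (computable_pair_nat ?_ (Computable.const _))
    refine computable_pair_nat ?_ (Computable.const 1)
    -- The encoding of the numerator, a nonnegative integer `n`, is `2 * n`.
    exact (Primrec.nat_mul.comp (Primrec.const 2) Primrec.id).to_comp
  · change ((n : ℚ) : ℝ) * 1 = n
    simp

theorem IsTerm.congr {T U} (hT : IsTerm T) (h : ∀ n v, T n v = U n v) : IsTerm U := by
  obtain rfl : T = U := funext fun n => funext (h n)
  exact hT

theorem IsTerm.sub {T U} (hT : IsTerm T) (hU : IsTerm U) : IsTerm fun n v => T n v - U n v :=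
  (hT.add (hU.smul (-1))).congr fun n v => by push_cast; ring

theorem IsIntTerm.cast {T} (hT : IsIntTerm T) : IsTerm fun n v => (T n v : ℝ) := hT

theorem IsIntTerm.const (z : ℤ) : IsIntTerm fun _ _ => z :=
  (IsTerm.one.smul (z : ℚ)).congr fun n v => by simp

theorem IsIntTerm.param : IsIntTerm fun n _ => (n : ℤ) :=
  IsTerm.param.congr fun n v => by simp

theorem IsIntTerm.add {T U} (hT : IsIntTerm T) (hU : IsIntTerm U) :
    IsIntTerm fun n v => T n v + U n v :=
  (IsTerm.add hT hU).congr fun n v => by push_cast; ring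

theorem IsIntTerm.sub {T U} (hT : IsIntTerm T) (hU : IsIntTerm U) :
    IsIntTerm fun n v => T n v - U n v :=
  (IsTerm.sub hT hU).congr fun n v => by push_cast; ring

theorem IsIntTerm.neg {T} (hT : IsIntTerm T) : IsIntTerm fun n v => -T n v :=
  (IsTerm.smul (-1) hT).congr fun n v => by push_cast; ring

theorem IsIntTerm.mul {U} (z : ℤ) (hU : IsIntTerm U) : IsIntTerm fun n v => z * U n v :=
  (IsTerm.smul (z : ℚ) hU).congr fun n v => by push_cast; ring

theorem IsQFForm.congr {P Q} (hP : IsQFForm P) (h : ∀ n v, P n v ↔ Q n v) : IsQFForm Q := by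
  obtain rfl : P = Q := funext fun n => funext fun v => propext (h n v)
  exact hP

theorem IsQFForm.false : IsQFForm fun _ _ => False :=
  ⟨fun _ => .falsum, fun _ => .falsum, computable_code_falsum, fun _ _ => Iff.rfl⟩

theorem IsQFForm.imp {P Q} (hP : IsQFForm P) (hQ : IsQFForm Q) :
    IsQFForm fun n v => P n v → Q n v := by
  obtain ⟨φ, h1, h2, h3⟩ := hP
  obtain ⟨ψ, g1, g2, g3⟩ := hQ
  refine ⟨fun n => (φ n).imp (ψ n), fun n => (h1 n).imp (g1 n), computable_code_imp h2 g2,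
    fun n x => ?_⟩
  change ((φ n).HoldsInt x → (ψ n).HoldsInt x) ↔ (P n _ → Q n _)
  rw [h3, g3]

theorem IsQFForm.not {P} (hP : IsQFForm P) : IsQFForm fun n v => ¬ P n v :=
  hP.imp .false

theorem IsQFForm.or {P Q} (hP : IsQFForm P) (hQ : IsQFForm Q) :
    IsQFForm fun n v => P n v ∨ Q n v :=
  (hP.not.imp hQ).congr fun n v => by tauto

theorem IsQFForm.and {P Q} (hP : IsQFForm P) (hQ : IsQFForm Q) :
    IsQFForm fun n v => P n v ∧ Q n v :=
  (hP.imp hQ.not).not.congr fun n v => by tauto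

theorem IsQFForm.forall_fin {k : ℕ} {P : Fin k → ℕ → (Fin 4 → Block) → Prop}
    (hP : ∀ i, IsQFForm (P i)) : IsQFForm fun n v => ∀ i, P i n v := by
  induction k with
  | zero => exact (IsQFForm.not .false).congr fun n v => by simp
  | succ k ih =>
    exact ((hP 0).and (ih fun i => hP i.succ)).congr fun n v => by rw [Fin.forall_fin_succ]

theorem IsTerm.lt {T U} (hT : IsTerm T) (hU : IsTerm U) : IsQFForm fun n v => T n v < U n v := by
  obtain ⟨t, ht, ht'⟩ := hT
  obtain ⟨u, hu, hu'⟩ := hU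
  refine ⟨fun n => .rel Rel.lt ![t n, u n], fun n => .of_isAtomic (.rel _ _), ?_, fun n x => ?_⟩
  · exact computable_pair_nat (Computable.const 2) (computable_pair_nat ht hu)
  · change (t n).val x < (u n).val x ↔ T n _ < U n _
    rw [ht', hu']

theorem IsTerm.le {T U} (hT : IsTerm T) (hU : IsTerm U) : IsQFForm fun n v => T n v ≤ U n v :=
  (hU.lt hT).not.congr fun _ _ => not_lt

theorem IsIntTerm.lt {T U} (hT : IsIntTerm T) (hU : IsIntTerm U) :
    IsQFForm fun n v => T n v < U n v :=
  (IsTerm.lt hT hU).congr fun _ _ => Int.cast_lt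

theorem IsIntTerm.le {T U} (hT : IsIntTerm T) (hU : IsIntTerm U) :
    IsQFForm fun n v => T n v ≤ U n v :=
  (IsTerm.le hT hU).congr fun _ _ => Int.cast_le

theorem IsIntTerm.eq {T U} (hT : IsIntTerm T) (hU : IsIntTerm U) :
    IsQFForm fun n v => T n v = U n v :=
  ((hT.le hU).and (hU.le hT)).congr fun _ _ => le_antisymm_iff.symm

theorem IsIntTerm.abs_lt_abs {T U} (hT : IsIntTerm T) (hU : IsIntTerm U) :
    IsQFForm fun n v => |T n v| < |U n v| :=
  (((hT.lt hU).or (hT.lt hU.neg)).and ((hT.neg.lt hU).or (hT.neg.lt hU.neg))).congr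
    fun n v => by rw [abs_eq_max_neg, max_lt_iff, lt_abs, lt_abs]

theorem IsIntTerm.abs_le_abs {T U} (hT : IsIntTerm T) (hU : IsIntTerm U) :
    IsQFForm fun n v => |T n v| ≤ |U n v| :=
  (hU.abs_lt_abs hT).not.congr fun _ _ => not_lt

/-- A definable family of predicates gives a computable family of `∃∀∃∀` sentences. -/
theorem IsQFForm.exists_sentences {R} (hR : IsQFForm R) :
    ∃ Φ : ℕ → Form 0, Computable (fun n => (Φ n).code) ∧ ∀ n, IsEAEA 3388 (Φ n) ∧
      (IsTrue (Φ n) ↔ ∃ v₁, ∀ v₂, ∃ v₃, ∀ v₄, R n ![v₁, v₂, v₃, v₄]) := by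
  obtain ⟨φ, h1, h2, h3⟩ := hR
  refine ⟨fun n => exBlock 3388 (allBlock 3388 (exBlock 3388 (allBlock 3388 (φ n)))),
    computable_code_exBlock _ (computable_code_allBlock _ (computable_code_exBlock _
      (computable_code_allBlock _ h2))), fun n => ⟨⟨φ n, h1 n, rfl⟩, ?_⟩⟩
  -- Only 66 of the 3388 variables of a block are read. Surjectivity of the reading map turns
  -- quantifiers over tuples into quantifiers over blocks.
  have hs : Function.Surjective fun (y : Fin 3388 → ℤ) =>
      ((fun i j => y (entry 3388 (by norm_num) i j)) : Block) :=
    exists_entry_eq (by norm_num)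
  rw [IsTrue, holdsInt_exBlock, hs.exists]
  refine exists_congr fun y₁ => ?_
  rw [holdsInt_allBlock, hs.forall]
  refine forall_congr' fun y₂ => ?_
  rw [holdsInt_exBlock, hs.exists]
  refine exists_congr fun y₃ => ?_
  rw [holdsInt_allBlock, hs.forall]
  refine forall_congr' fun y₄ => ?_
  rw [h3, readBlocks_append]

end SinPA

/-! ### Finite sets of integer vectors coded by sines of integers. -/

namespace SinPA

open Set

/-! ### Integers modulo `2π` -/

theorem dense_int_add_two_pi : Dense {t : ℝ | ∃ b k : ℤ, t = b + 2 * Real.pi * k} := by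
  have hirr : Irrational (1 / (2 * Real.pi)) := by
    rw [one_div, irrational_inv_iff]
    exact_mod_cast irrational_pi.ratCast_mul (q := 2) (by norm_num)
  refine (dense_addSubgroupClosure_pair_iff.2 hirr).mono fun t ht => ?_
  obtain ⟨b, k, h⟩ := AddSubgroup.mem_closure_pair.1 ht
  refine ⟨b, k, ?_⟩
  rw [← h]
  simp only [zsmul_eq_mul]
  ring

theorem exists_int_add_two_pi_mem {V : Set ℝ} (hV : IsOpen V) (hne : V.Nonempty) (r : ℝ) (B : ℤ) :
    ∃ b k : ℤ, |B| < |b| ∧ b + r + 2 * Real.pi * k ∈ V := by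
  -- These are the reals congruent modulo `2π` to `b + r` with `|b| ≤ |B|`. The set is closed and
  -- countable, so removing it from `V` leaves a nonempty open set.
  set W : Set ℝ := ⋃ b ∈ Icc (-|B|) |B|, {t : ℝ | Real.cos (t - b - r) = 1} with hW
  have hclosed : IsClosed W := by
    refine (finite_Icc _ _).isClosed_biUnion fun b _ => ?_
    exact isClosed_eq (by fun_prop) continuous_const
  have hcount : W.Countable := by
    refine (finite_Icc _ _).countable.biUnion fun b _ => ?_
    refine (countable_range fun k : ℤ => (b : ℝ) + r + k * (2 * Real.pi)).mono ?_
    intro t ht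
    obtain ⟨k, hk⟩ := (Real.cos_eq_one_iff _).1 ht
    exact ⟨k, by simp only; linarith⟩
  obtain ⟨p, hpV, hpW⟩ := (hcount.dense_compl ℝ).inter_open_nonempty V hV hne
  have hO : IsOpen ((fun t => t + r) ⁻¹' (V ∩ Wᶜ)) :=
    (hV.inter hclosed.isOpen_compl).preimage (by fun_prop)
  obtain ⟨t, ht, b, k, rfl⟩ := dense_int_add_two_pi.inter_open_nonempty _ hO
    ⟨p - r, by simpa using ⟨hpV, hpW⟩⟩
  refine ⟨b, k, ?_, ?_⟩
  · by_contra hb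
    refine ht.2 ?_
    rw [hW, mem_iUnion₂]
    refine ⟨b, abs_le.1 (not_lt.1 hb), ?_⟩
    rw [mem_ofPred_eq, Real.cos_eq_one_iff]
    exact ⟨k, by ring⟩
  · convert ht.1 using 1
    ring

theorem int_add_two_pi_injective {b b' k : ℤ} (h : (b : ℝ) = b' + 2 * Real.pi * k) : b = b' := by
  by_cases hk : k = 0
  · subst hk
    exact_mod_cast (by simpa using h : (b : ℝ) = b')
  · have h2 : Irrational (Real.pi * ((2 * k : ℤ) : ℝ)) :=
      irrational_pi.mul_intCast (by omega)
    refine absurd ?_ (h2.ne_int (b - b'))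
    push_cast
    linarith

/-! ### Generic phases -/

theorem countable_cos_eq (c : ℝ) : {u : ℝ | Real.cos u = c}.Countable := by
  rcases eq_empty_or_nonempty {u : ℝ | Real.cos u = c} with h | ⟨v, hv⟩
  · rw [h]; exact countable_empty
  · refine ((countable_range fun k : ℤ => 2 * k * Real.pi + v).union
      (countable_range fun k : ℤ => 2 * k * Real.pi - v)).mono fun u hu => ?_
    obtain ⟨k, hk | hk⟩ := Real.cos_eq_cos_iff.1 ((hv : Real.cos v = c).trans hu.symm)
    · exact .inl ⟨k, hk.symm⟩
    · exact .inr ⟨k, hk.symm⟩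

/-- The difference is `2 sin ((a - b) / 2) cos (t + (a + b) / 2)`. Its first factor is nonzero
because `π` is irrational, so the cosine is prescribed. -/
theorem countable_sin_sub_sin_eq {a b : ℤ} (hab : a ≠ b) (c : ℝ) :
    {t : ℝ | Real.sin (a + t) - Real.sin (b + t) = c}.Countable := by
  have hs : Real.sin (((a : ℝ) - b) / 2) ≠ 0 := by
    intro h
    obtain ⟨k, hk⟩ := Real.sin_eq_zero_iff.1 h
    exact hab (int_add_two_pi_injective (k := k) (by linarith))
  refine ((countable_cos_eq (c / (2 * Real.sin (((a : ℝ) - b) / 2)))).preimage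
    (f := fun t : ℝ => t + (a + b) / 2) (add_left_injective _)).mono fun t ht => ?_
  rw [mem_preimage, mem_ofPred_eq, eq_div_iff (by simpa using hs), ← (ht : _ = c),
    Real.sin_sub_sin]
  have h1 : ((a : ℝ) + t - (b + t)) / 2 = (a - b) / 2 := by ring
  have h2 : ((a : ℝ) + t + (b + t)) / 2 = t + (a + b) / 2 := by ring
  rw [h1, h2]
  ring

/-- The sum of the sines of the shifted coordinates of an integer vector. -/
noncomputable def phase {d : ℕ} (θ : Fin d → ℝ) (s : Fin d → ℤ) : ℝ :=
  ∑ j, Real.sin (s j + θ j)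

/-- Choose the shifts one at a time, each outside a countable bad set. Where the new coordinates of
`s` and `s'` agree, their sines cancel and the earlier shifts decide. -/
theorem exists_phase_sub_notMem {Q : Set ℝ} (hQ : Q.Countable) (d : ℕ) :
    ∃ θ : Fin d → ℝ, ∀ s s' : Fin d → ℤ, s ≠ s' → phase θ s - phase θ s' ∉ Q := by
  induction d with
  | zero => exact ⟨Fin.elim0, fun s s' h => absurd (Subsingleton.elim s s') h⟩
  | succ d ih =>
    obtain ⟨θ, hθ⟩ := ih
    set bad : Set ℝ := ⋃ s : Fin (d + 1) → ℤ, ⋃ s' : Fin (d + 1) → ℤ, ⋃ _ : s 0 ≠ s' 0,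
      ⋃ q ∈ Q, {t : ℝ | Real.sin (s 0 + t) - Real.sin (s' 0 + t) =
        q - (phase θ (Fin.tail s) - phase θ (Fin.tail s'))} with hbad
    have hcount : bad.Countable := by
      refine countable_iUnion fun s => countable_iUnion fun s' => countable_iUnion fun h => ?_
      exact hQ.biUnion fun q _ => countable_sin_sub_sin_eq h _
    obtain ⟨t, ht⟩ := (hcount.dense_compl ℝ).nonempty
    have hphase (s : Fin (d + 1) → ℤ) :
        phase (Fin.cons t θ : Fin (d + 1) → ℝ) s =
          Real.sin (s 0 + t) + phase θ (Fin.tail s) := by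
      simp [phase, Fin.sum_univ_succ, Fin.tail]
    refine ⟨Fin.cons t θ, fun s s' hss hmem => ?_⟩
    rw [hphase, hphase] at hmem
    by_cases h0 : s 0 = s' 0
    · refine hθ (Fin.tail s) (Fin.tail s') (fun h => hss ?_) ?_
      · rw [← Fin.cons_self_tail s, ← Fin.cons_self_tail s', h, h0]
      · rw [h0] at hmem
        simpa using hmem
    · refine ht ?_
      simp only [hbad, mem_iUnion, mem_ofPred_eq]
      exact ⟨s, s', h0, _, hmem, by ring⟩

theorem exists_generic_phase (d : ℕ) :
    ∃ θ : Fin d → ℝ, ∀ (s s' : Fin d → ℤ) (b b' k : ℤ),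
      b + phase θ s = b' + phase θ s' + 2 * Real.pi * k → s = s' ∧ b = b' := by
  obtain ⟨θ, hθ⟩ := exists_phase_sub_notMem
    (countable_range fun p : ℤ × ℤ => (p.1 : ℝ) + 2 * Real.pi * p.2) d
  refine ⟨θ, fun s s' b b' k h => ?_⟩
  by_cases hs : s = s'
  · subst hs
    exact ⟨rfl, int_add_two_pi_injective (k := k) (by linarith)⟩
  · exact absurd ⟨(b' - b, k), by push_cast; linarith⟩ (hθ s s' hs)

/-! ### Coding finite sets of integer vectors -/

/-- How well the vector `s` and the integer `b` together approximate `c - π / 2`. -/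
noncomputable def score {d : ℕ} (θ : Fin d → ℝ) (c : ℝ) (s : Fin d → ℤ) (b : ℤ) : ℝ :=
  Real.sin (c - b - phase θ s)

/-- The vector `s` is marked by the code `(θ, c, c', S, N)`: with a suitable `b` it has the best
score up to some bound `n` that approximates `c'` better than everything up to `b`. -/
def Marked {d : ℕ} (θ : Fin d → ℝ) (c c' : ℝ) (S N : ℤ) (s : Fin d → ℤ) : Prop :=
  (∀ j, |s j| ≤ |S|) ∧ ∃ b n : ℤ, |b| < |n| ∧ |n| ≤ |N| ∧
    (∀ y : ℤ, |y| ≤ |b| → Real.sin (c' - y) < Real.sin (c' - n)) ∧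
    ∀ (w : Fin d → ℤ) (b' : ℤ), (∀ j, |w j| ≤ |S|) → |b'| ≤ |n| →
      score θ c w b' ≤ score θ c s b

theorem isOpen_forall_lt {ι X : Type*} [TopologicalSpace X] {A : Set ι} (hA : A.Finite)
    {f g : ι → X → ℝ} (hf : ∀ i, Continuous (f i)) (hg : ∀ i, Continuous (g i)) :
    IsOpen {x | ∀ i ∈ A, f i x < g i x} := by
  simp only [ofPred_forall]
  exact hA.isOpen_biInter fun i _ => isOpen_lt (hf i) (hg i)

theorem finite_abs_le (N : ℤ) : {y : ℤ | |y| ≤ |N|}.Finite :=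
  (finite_Icc (-|N|) |N|).subset fun _ hy => abs_le.1 hy

theorem finite_box (d : ℕ) (S : ℤ) : {w : Fin d → ℤ | ∀ j, |w j| ≤ |S|}.Finite :=
  (Finite.pi' fun _ => finite_abs_le S)

theorem sin_lt_one_of_ne {u : ℝ} (h : ∀ k : ℤ, u ≠ Real.pi / 2 + k * (2 * Real.pi)) :
    Real.sin u < 1 := by
  refine lt_of_le_of_ne (Real.sin_le_one u) fun h1 => ?_
  obtain ⟨k, hk⟩ := Real.sin_eq_one_iff.1 h1
  exact h k hk.symm

/-- Induction on the list: each new vector wins at a scale beyond all previous ones, and shrinking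
the open sets preserves the earlier winners. The record `N` with `sin (c' - N) = 1` at some centre
is carried along to start the next scale. Genericity is needed only at `θ₀`; openness transfers the
inequalities to its neighbours. -/
theorem exists_open_codes {d : ℕ} (S : ℤ) {θ₀ : Fin d → ℝ}
    (hθ : ∀ (s s' : Fin d → ℤ) (b b' k : ℤ),
      b + phase θ₀ s = b' + phase θ₀ s' + 2 * Real.pi * k → s = s' ∧ b = b')
    (l : List (Fin d → ℤ)) (hl : ∀ s ∈ l, ∀ j, |s j| ≤ |S|) :
    ∃ (U : Set ((Fin d → ℝ) × ℝ)) (U' : Set ℝ) (N : ℤ), IsOpen U ∧ IsOpen U' ∧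
      (∃ c, (θ₀, c) ∈ U) ∧ (∃ c' ∈ U', Real.sin (c' - N) = 1) ∧
      (∀ c' ∈ U', ∀ y : ℤ, |y| < |N| → Real.sin (c' - y) < Real.sin (c' - N)) ∧
      ∀ p ∈ U, ∀ c' ∈ U', ∀ s, Marked p.1 p.2 c' S N s ↔ s ∈ l := by
  induction l with
  | nil =>
    refine ⟨univ, univ, 0, isOpen_univ, isOpen_univ, ⟨0, trivial⟩,
      ⟨Real.pi / 2, trivial, by simp⟩, fun _ _ y hy => ?_, fun _ _ _ _ s => ?_⟩
    · simp at hy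
      exact absurd hy (abs_nonneg y).not_gt
    · simp only [List.not_mem_nil, iff_false]
      rintro ⟨-, b, n, h1, h2, -⟩
      have := abs_nonneg b
      simp only [abs_zero] at h2
      omega
  | cons s l ih =>
    obtain ⟨U, U', N, hU, hU', ⟨c₀, hc₀⟩, ⟨c₀', hc₀', hN⟩, hrec, hmark⟩ :=
      ih fun s' hs' => hl s' (List.mem_cons_of_mem _ hs')
    have hs := hl s List.mem_cons_self
    have hslice : IsOpen {c | (θ₀, c) ∈ U} := hU.preimage (by fun_prop)
    -- This puts `c` where the score of `(s, b)` is exactly `1`, with `|b|` beyond the old scale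
    -- `|N|`.
    obtain ⟨b, k, hNb, hb⟩ := exists_int_add_two_pi_mem hslice ⟨c₀, hc₀⟩
      (phase θ₀ s + Real.pi / 2) N
    have hinj' : ∀ {c' : ℝ} {n y : ℤ}, Real.sin (c' - n) = 1 → y ≠ n →
        Real.sin (c' - y) < Real.sin (c' - n) := by
      intro c' n y hn hy
      rw [hn]
      refine sin_lt_one_of_ne fun k hk => hy ?_
      obtain ⟨m, hm⟩ := Real.sin_eq_one_iff.1 hn
      exact int_add_two_pi_injective (k := m - k) (by push_cast; linarith)
    -- Keeping `N` strictly best up to `|b|` ensures that any integer beating it exceeds `|b|` in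
    -- absolute value. Hence no false scale stops before `b`.
    set U₁ : Set ℝ := U' ∩ {c' | ∀ y ∈ {y : ℤ | |y| ≤ |b|} \ {N},
      Real.sin (c' - y) < Real.sin (c' - N)} with hU₁
    have hU₁o : IsOpen U₁ := hU'.inter <| isOpen_forall_lt ((finite_abs_le b).sdiff)
      (fun _ => by fun_prop) (fun _ => by fun_prop)
    have hc₁ : c₀' ∈ U₁ := ⟨hc₀', fun y hy => hinj' hN hy.2⟩
    obtain ⟨M, m, hbM, hM⟩ := exists_int_add_two_pi_mem hU₁o ⟨_, hc₁⟩ (Real.pi / 2) b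
    have hM1 : Real.sin (M + Real.pi / 2 + 2 * Real.pi * m - M) = 1 :=
      Real.sin_eq_one_iff.2 ⟨m, by ring⟩
    set U₂' : Set ℝ := U₁ ∩ {c' | ∀ y ∈ {y : ℤ | |y| ≤ |M|} \ {M},
      Real.sin (c' - y) < Real.sin (c' - M)} with hU₂'
    set U₂ : Set ((Fin d → ℝ) × ℝ) := U ∩ {p | ∀ q ∈
      ({w : Fin d → ℤ | ∀ j, |w j| ≤ |S|} ×ˢ {y : ℤ | |y| ≤ |M|}) \ {(s, b)},
        score p.1 p.2 q.1 q.2 < score p.1 p.2 s b} with hU₂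
    have hcont : ∀ (w : Fin d → ℤ) (y : ℤ),
        Continuous fun p : (Fin d → ℝ) × ℝ => score p.1 p.2 w y := by
      intro w y
      unfold score phase
      fun_prop
    refine ⟨U₂, U₂', M, hU.inter ?_, hU₁o.inter ?_, ⟨_, hb, ?_⟩, ⟨_, ⟨hM, ?_⟩, hM1⟩, ?_, ?_⟩
    · exact isOpen_forall_lt (((finite_box d S).prod (finite_abs_le M)).sdiff)
        (fun q => hcont q.1 q.2) fun _ => hcont s b
    · exact isOpen_forall_lt ((finite_abs_le M).sdiff) (fun _ => by fun_prop)
        (fun _ => by fun_prop)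
    · rintro ⟨w, y⟩ ⟨-, hne⟩
      have h1 : score θ₀ (b + (phase θ₀ s + Real.pi / 2) + 2 * Real.pi * k) s b = 1 :=
        Real.sin_eq_one_iff.2 ⟨k, by ring⟩
      simp only
      rw [h1]
      refine sin_lt_one_of_ne fun i hi => hne ?_
      obtain ⟨rfl, rfl⟩ := hθ s w b y (i - k) (by push_cast; linarith)
      rfl
    · exact fun y hy => hinj' hM1 hy.2
    · exact fun c' hc' y hy => hc'.2 y ⟨hy.le, by rintro rfl; exact lt_irrefl _ hy⟩
    · intro p hp c' hc' s₀
      rw [List.mem_cons, ← hmark p hp.1 c' hc'.1.1]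
      constructor
      · rintro ⟨hbox, b₀, n₀, hlt, hle, hn, hbest⟩
        by_cases hnN : |n₀| ≤ |N|
        · exact .inr ⟨hbox, b₀, n₀, hlt, hnN, hn, hbest⟩
        push Not at hnN
        -- A winner up to `|n₀|` with `|b₀| < |N| < |n₀|` also wins up to the old scale `N`.
        by_cases hbN : |b₀| < |N|
        · exact .inr ⟨hbox, b₀, N, hbN, le_rfl, fun y hy => hrec c' hc'.1.1 y (hy.trans_lt hbN),
            fun w b' hw hb' => hbest w b' hw (hb'.trans hnN.le)⟩
        push Not at hbN
        left
        -- Since `|N| ≤ |b₀|`, the integer `n₀` beats `N`, so it lies beyond `b`. Then `(s, b)`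
        -- competes against `(s₀, b₀)`, and it is the unique winner up to `|M|`.
        have hbn : |b| < |n₀| := by
          by_contra hcon
          have h1 := hn N hbN
          have h2 := hc'.1.2 n₀ ⟨not_lt.1 hcon, by rintro rfl; exact lt_irrefl _ hnN⟩
          exact lt_asymm h1 h2
        by_contra hne
        refine (hbest s b hs hbn.le).not_gt (hp.2 (s₀, b₀) ⟨⟨hbox, hlt.le.trans hle⟩, ?_⟩)
        intro h
        exact hne (Prod.ext_iff.1 h).1
      · rintro (rfl | ⟨hbox, b₀, n₀, hlt, hle, hn, hbest⟩)
        · refine ⟨hs, b, M, hbM, le_rfl, fun y hy => hc'.2 y ⟨hy.trans hbM.le, ?_⟩, ?_⟩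
          · rintro rfl
            exact hbM.not_ge hy
          · intro w b' hw hb'
            by_cases heq : (w, b') = (s₀, b)
            · obtain ⟨rfl, rfl⟩ := Prod.ext_iff.1 heq
              exact le_rfl
            · exact (hp.2 (w, b') ⟨⟨hw, hb'⟩, heq⟩).le
        · exact ⟨hbox, b₀, n₀, hlt, hle.trans (hNb.trans hbM).le, hn, hbest⟩

/-- The real parameters occur only inside sines, so only their classes modulo `2π` matter. This
replaces points of `ℤ + 2πℤ` by integers. -/
theorem marked_congr {d : ℕ} {θ θ' : Fin d → ℝ} {c₁ c₂ c₁' c₂' : ℝ}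
    (hθ : ∀ j, ∃ k : ℤ, θ j = θ' j + k * (2 * Real.pi)) (hc : ∃ k : ℤ, c₁ = c₂ + k * (2 * Real.pi))
    (hc' : ∃ k : ℤ, c₁' = c₂' + k * (2 * Real.pi)) (S N : ℤ) (s : Fin d → ℤ) :
    Marked θ c₁ c₁' S N s ↔ Marked θ' c₂ c₂' S N s := by
  have hphase : ∀ s : Fin d → ℤ, phase θ s = phase θ' s := by
    refine fun s => Finset.sum_congr rfl fun j _ => ?_
    obtain ⟨k, hk⟩ := hθ j
    rw [hk, ← add_assoc, Real.sin_add_int_mul_two_pi]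
  have hscore : ∀ (s : Fin d → ℤ) (b : ℤ), score θ c₁ s b = score θ' c₂ s b := by
    intro s b
    obtain ⟨k, rfl⟩ := hc
    rw [score, score, hphase, ← Real.sin_add_int_mul_two_pi (c₂ - b - phase θ' s) k]
    ring_nf
  have hsin : ∀ y : ℤ, Real.sin (c₁' - y) = Real.sin (c₂' - y) := by
    intro y
    obtain ⟨k, rfl⟩ := hc'
    rw [← Real.sin_add_int_mul_two_pi (c₂' - y) k]
    ring_nf
  simp only [Marked, hscore, hsin]

/-- Every finite set of integer vectors has an integer code. -/
theorem exists_code {d : ℕ} (S : ℤ) (l : List (Fin d → ℤ)) (hl : ∀ s ∈ l, ∀ j, |s j| ≤ |S|) :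
    ∃ (Θ : Fin d → ℤ) (C C' N : ℤ), ∀ s,
      Marked (fun j => (Θ j : ℝ)) C C' S N s ↔ s ∈ l := by
  obtain ⟨θ₀, hθ⟩ := exists_generic_phase d
  obtain ⟨U, U', N, hU, hU', ⟨c, hc⟩, ⟨c', hc', -⟩, -, hmark⟩ := exists_open_codes S hθ l hl
  have hd := dense_int_add_two_pi
  obtain ⟨p, hp, hpθ, C, k, hpc⟩ := ((dense_pi univ fun (_ : Fin d) _ => hd).prod
    hd).inter_open_nonempty U hU ⟨_, hc⟩
  obtain ⟨q, hq, C', k', hqc⟩ := hd.inter_open_nonempty U' hU' ⟨_, hc'⟩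
  choose Θ m hΘ using fun j => hpθ j (mem_univ j)
  refine ⟨Θ, C, C', N, fun s => ?_⟩
  rw [← hmark p hp q hq s]
  exact marked_congr (fun j => ⟨-m j, by rw [hΘ]; push_cast; ring⟩)
    ⟨-k, by rw [hpc]; push_cast; ring⟩ ⟨-k', by rw [hqc]; push_cast; ring⟩ S N s

end SinPA

/-! ### Recursive functions as finite derivations. -/

namespace SinPA

open Nat.Partrec Encodable

/-! ### Facts about evaluation of codes and rules to infer them -/

/-- A fact `(e, x, y, t)` says that `y = x ^ 2` if `e = -1`, and that `y` is the value at `x` of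
the partial recursive function with code `e` if `e ≥ 0`. The number `t` is its rank. -/
abbrev Fact : Type := Fin 4 → ℤ

/-- The fact is true. -/
def Fact.Holds (s : Fact) : Prop :=
  (s 0 = -1 ∧ ∃ a : ℕ, s 1 = a ∧ s 2 = a * a) ∨
    ∃ (c : Code) (a v : ℕ), s 0 = encode c ∧ s 1 = a ∧ s 2 = v ∧ v ∈ c.eval a

/-- By the fact `q` about a square, `z` is the code of the pair `(a, b)`. -/
def IsPair (q : Fact) (a b z : ℤ) : Prop :=
  q 0 = -1 ∧ 0 ≤ a ∧ 0 ≤ b ∧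
    ((a < b ∧ q 1 = b ∧ z = q 2 + a) ∨ (b ≤ a ∧ q 1 = a ∧ z = q 2 + a + b))

/-- The facts that need no premises. -/
def IsAxiomFact (s : Fact) : Prop :=
  0 ≤ s 3 ∧ ((s 0 = -1 ∧ s 1 = 0 ∧ s 2 = 0) ∨ (s 0 = 0 ∧ 0 ≤ s 1 ∧ s 2 = 0) ∨
    (s 0 = 1 ∧ 0 ≤ s 1 ∧ s 2 = s 1 + 1))

/-- The fact `s` follows from the facts `p` by one of the rules, with auxiliary numbers `u`. -/
def Infers (s : Fact) (p : Fin 7 → Fact) (u : Fin 6 → ℤ) : Prop :=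
  (s 0 = -1 ∧ p 0 0 = -1 ∧ p 0 1 = s 1 - 1 ∧ p 0 2 = s 2 - 2 * s 1 + 1) ∨
  (s 0 = 2 ∧ IsPair (p 0) (s 2) (u 0) (s 1)) ∨
  (s 0 = 3 ∧ IsPair (p 0) (u 0) (s 2) (s 1)) ∨
  (s 0 = 4 * u 0 + 4 ∧ IsPair (p 0) (p 1 0) (p 2 0) (u 0) ∧ p 1 1 = s 1 ∧ p 2 1 = s 1 ∧
    IsPair (p 3) (p 1 2) (p 2 2) (s 2)) ∨
  (s 0 = 4 * u 0 + 6 ∧ IsPair (p 0) (p 1 0) (p 2 0) (u 0) ∧ p 2 1 = s 1 ∧ p 1 1 = p 2 2 ∧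
    p 1 2 = s 2) ∨
  (s 0 = 4 * u 0 + 5 ∧ IsPair (p 0) (p 2 0) (u 1) (u 0) ∧ IsPair (p 1) (p 2 1) 0 (s 1) ∧
    p 2 2 = s 2) ∨
  (s 0 = 4 * u 0 + 5 ∧ IsPair (p 0) (u 1) (p 6 0) (u 0) ∧ IsPair (p 1) (u 2) (u 3 + 1) (s 1) ∧
    IsPair (p 2) (u 2) (u 3) (p 3 1) ∧ p 3 0 = s 0 ∧ IsPair (p 4) (u 3) (p 3 2) (u 4) ∧
    IsPair (p 5) (u 2) (u 4) (p 6 1) ∧ p 6 2 = s 2) ∨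
  (0 ≤ p 1 0 ∧ s 0 = 4 * p 1 0 + 7 ∧ p 1 1 = s 1 ∧ p 1 2 = 0 ∧ IsPair (p 0) (u 2) (s 2) (s 1)) ∨
  (0 ≤ p 1 0 ∧ s 0 = 4 * p 1 0 + 7 ∧ p 1 1 = s 1 ∧ 1 ≤ p 1 2 ∧ IsPair (p 0) (u 2) (u 3) (s 1) ∧
    IsPair (p 2) (u 2) (u 3 + 1) (p 3 1) ∧ p 3 0 = s 0 ∧ p 3 2 = s 2)

/-- The fact `s` follows by a rule from premises of smaller rank. -/
def RankedInfers (s : Fact) (p : Fin 7 → Fact) (u : Fin 6 → ℤ) : Prop :=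
  Infers s p u ∧ ∀ j, 0 ≤ p j 3 ∧ p j 3 < s 3

/-- Every fact in the set is an axiom or follows from facts in the set by a rule. -/
def IsClosedUnder (X : Set Fact) : Prop :=
  ∀ s ∈ X, IsAxiomFact s ∨ ∃ p u, RankedInfers s p u ∧ ∀ j, p j ∈ X

/-! ### Soundness of the rules -/

theorem Fact.Holds.eval {s : Fact} (h : s.Holds) (h0 : 0 ≤ s 0) :
    ∃ (c : Code) (a v : ℕ), s 0 = encode c ∧ s 1 = a ∧ s 2 = v ∧ v ∈ c.eval a := by
  rcases h with ⟨h, -⟩ | h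
  · omega
  · exact h

theorem IsPair.eq_pair {q : Fact} {a b z : ℤ} (h : IsPair q a b z) (hq : q.Holds) :
    ∃ A B : ℕ, a = A ∧ b = B ∧ z = Nat.pair A B := by
  obtain ⟨h0, ha, hb, h⟩ := h
  rcases hq with ⟨-, m, h1, h2⟩ | ⟨c, _, _, h1, -⟩
  · lift a to ℕ using ha
    lift b to ℕ using hb
    refine ⟨a, b, rfl, rfl, ?_⟩
    rcases h with ⟨hab, hm, rfl⟩ | ⟨hab, hm, rfl⟩
    · obtain rfl : m = b := by omega
      rw [h2, Nat.pair, if_pos (by omega)]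
      push_cast
      rfl
    · obtain rfl : m = a := by omega
      rw [h2, Nat.pair, if_neg (by omega)]
      push_cast
      rfl
  · omega

/-- Needed in the recursion rules, where one of the two subcodes is only an auxiliary number and no
premise vouches for it. -/
theorem exists_code_encode (n : ℕ) : ∃ c : Code, encode c = n :=
  ⟨Denumerable.ofNat Code n, Denumerable.encode_ofNat n⟩

theorem encode_pair (cf cg : Code) :
    encode (Code.pair cf cg) = 4 * Nat.pair (encode cf) (encode cg) + 4 := by
  simp only [Code.encodeCode_eq, Code.encodeCode]; ring

theorem encode_comp (cf cg : Code) :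
    encode (Code.comp cf cg) = 4 * Nat.pair (encode cf) (encode cg) + 6 := by
  simp only [Code.encodeCode_eq, Code.encodeCode]; ring

theorem encode_prec (cf cg : Code) :
    encode (Code.prec cf cg) = 4 * Nat.pair (encode cf) (encode cg) + 5 := by
  simp only [Code.encodeCode_eq, Code.encodeCode]; ring

theorem encode_rfind' (cf : Code) : encode (Code.rfind' cf) = 4 * encode cf + 7 := by
  simp only [Code.encodeCode_eq, Code.encodeCode]; ring

theorem mem_eval_pair {cf cg : Code} {a v : ℕ} :
    v ∈ (Code.pair cf cg).eval a ↔ ∃ x ∈ cf.eval a, ∃ y ∈ cg.eval a, Nat.pair x y = v := by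
  simp [Code.eval, Seq.seq]

theorem mem_eval_comp {cf cg : Code} {a v : ℕ} :
    v ∈ (Code.comp cf cg).eval a ↔ ∃ x ∈ cg.eval a, v ∈ cf.eval x :=
  Part.mem_bind_iff

theorem mem_eval_prec_succ {cf cg : Code} {a k v : ℕ} :
    v ∈ (Code.prec cf cg).eval (Nat.pair a (k + 1)) ↔
      ∃ i ∈ (Code.prec cf cg).eval (Nat.pair a k), v ∈ cg.eval (Nat.pair a (Nat.pair k i)) := by
  rw [Code.eval_prec_succ]
  simp

theorem mem_eval_rfind' {cf : Code} {a m v : ℕ} :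
    v ∈ (Code.rfind' cf).eval (Nat.pair a m) ↔
      ∃ n, v = n + m ∧ 0 ∈ cf.eval (Nat.pair a (n + m)) ∧
        ∀ j < n, ∃ y ∈ cf.eval (Nat.pair a (j + m)), y ≠ 0 := by
  simp only [Code.eval, Nat.unpaired, Nat.unpair_pair, Part.mem_map_iff]
  constructor
  · rintro ⟨n, hn, rfl⟩
    obtain ⟨h1, h2⟩ := Nat.mem_rfind.1 hn
    refine ⟨n, rfl, ?_, fun j hj => ?_⟩
    · simpa using h1
    · simpa using h2 hj
  · rintro ⟨n, rfl, h1, h2⟩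
    refine ⟨n, Nat.mem_rfind.2 ⟨?_, fun {j} hj => ?_⟩, rfl⟩
    · simpa using h1
    · simpa using h2 j hj

theorem mem_eval_rfind'_of_zero {cf : Code} {a m : ℕ} (h : 0 ∈ cf.eval (Nat.pair a m)) :
    m ∈ (Code.rfind' cf).eval (Nat.pair a m) :=
  mem_eval_rfind'.2 ⟨0, by simp, by simpa using h, by simp⟩

theorem mem_eval_rfind'_of_succ {cf : Code} {a m v y : ℕ} (h : y ∈ cf.eval (Nat.pair a m))
    (hy : y ≠ 0) (hv : v ∈ (Code.rfind' cf).eval (Nat.pair a (m + 1))) :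
    v ∈ (Code.rfind' cf).eval (Nat.pair a m) := by
  obtain ⟨n, rfl, h1, h2⟩ := mem_eval_rfind'.1 hv
  refine mem_eval_rfind'.2 ⟨n + 1, by ring, ?_, fun j hj => ?_⟩
  · rwa [show n + 1 + m = n + (m + 1) by ring]
  · rcases j with _ | j
    · exact ⟨y, by simpa using h, hy⟩
    · rw [show j + 1 + m = j + (m + 1) by ring]
      exact h2 j (by omega)

theorem Infers.holds {s : Fact} {p : Fin 7 → Fact} {u : Fin 6 → ℤ} (h : Infers s p u)
    (hp : ∀ j, (p j).Holds) : s.Holds := by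
  rcases h with ⟨h0, h1, h2, h3⟩ | ⟨h0, h1⟩ | ⟨h0, h1⟩ | ⟨h0, h1, h2, h3, h4⟩ |
    ⟨h0, h1, h2, h3, h4⟩ | ⟨h0, h1, h2, h3⟩ | ⟨h0, h1, h2, h3, h4, h5, h6, h7⟩ |
    ⟨hf, h0, h1, h2, h3⟩ | ⟨hf, h0, h1, h2, h3, h4, h5, h6⟩
  -- The nine rules in order: squares, `left`, `right`, `pair`, `comp`, `prec` at zero, `prec` at a
  -- successor, `rfind'` stopping, `rfind'` continuing.
  · rcases hp 0 with ⟨-, a, ha, hb⟩ | ⟨c, _, _, hc, -⟩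
    · refine .inl ⟨h0, a + 1, by push_cast; omega, ?_⟩
      have hs : s 1 = a + 1 := by omega
      rw [hs] at h3
      push_cast
      linarith
    · omega
  · obtain ⟨A, B, hA, hB, hz⟩ := h1.eq_pair (hp 0)
    exact .inr ⟨.left, Nat.pair A B, A, h0, hz, hA, by simp [Code.eval]⟩
  · obtain ⟨A, B, hA, hB, hz⟩ := h1.eq_pair (hp 0)
    exact .inr ⟨.right, Nat.pair A B, B, h0, hz, hB, by simp [Code.eval]⟩
  · obtain ⟨A, B, hA, hB, hz⟩ := h1.eq_pair (hp 0)
    obtain ⟨cf, a, v, e1, e2, e3, e4⟩ := (hp 1).eval h1.2.1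
    obtain ⟨cg, a', w, e1', e2', e3', e4'⟩ := (hp 2).eval h1.2.2.1
    obtain ⟨A', B', hA', hB', hz'⟩ := h4.eq_pair (hp 3)
    obtain rfl : A = encode cf := by omega
    obtain rfl : B = encode cg := by omega
    obtain rfl : a = a' := by omega
    obtain rfl : A' = v := by omega
    obtain rfl : B' = w := by omega
    refine .inr ⟨.pair cf cg, a, Nat.pair A' B', ?_, by omega, hz',
      mem_eval_pair.2 ⟨_, e4, _, e4', rfl⟩⟩
    rw [encode_pair, h0, hz]
    push_cast
    rfl
  · obtain ⟨A, B, hA, hB, hz⟩ := h1.eq_pair (hp 0)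
    obtain ⟨cf, a, v, e1, e2, e3, e4⟩ := (hp 1).eval h1.2.1
    obtain ⟨cg, a', w, e1', e2', e3', e4'⟩ := (hp 2).eval h1.2.2.1
    obtain rfl : A = encode cf := by omega
    obtain rfl : B = encode cg := by omega
    obtain rfl : a = w := by omega
    refine .inr ⟨.comp cf cg, a', v, ?_, by omega, by omega, mem_eval_comp.2 ⟨_, e4', e4⟩⟩
    rw [encode_comp, h0, hz]
    push_cast
    rfl
  · obtain ⟨A, B, hA, hB, hz⟩ := h1.eq_pair (hp 0)
    obtain ⟨A', B', hA', hB', hz'⟩ := h2.eq_pair (hp 1)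
    obtain ⟨cf, a, v, e1, e2, e3, e4⟩ := (hp 2).eval h1.2.1
    obtain ⟨cg, rfl⟩ := exists_code_encode B
    obtain rfl : A = encode cf := by omega
    obtain rfl : A' = a := by omega
    obtain rfl : B' = 0 := by omega
    refine .inr ⟨.prec cf cg, Nat.pair A' 0, v, ?_, hz', by omega, ?_⟩
    · rw [encode_prec, h0, hz]
      push_cast
      rfl
    · rwa [Code.eval_prec_zero]
  · obtain ⟨F, G, hF, hG, hz⟩ := h1.eq_pair (hp 0)
    obtain ⟨a, k', ha, hk', hx⟩ := h2.eq_pair (hp 1)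
    obtain ⟨a', k, ha', hk, hx'⟩ := h3.eq_pair (hp 2)
    obtain ⟨k₁, i, hk₁, hi, hz₁⟩ := h5.eq_pair (hp 4)
    obtain ⟨a₁, z₁, ha₁, hz₂, hw⟩ := h6.eq_pair (hp 5)
    obtain ⟨cg, b, v, e1, e2, e3, e4⟩ := (hp 6).eval h1.2.2.1
    obtain ⟨cf, rfl⟩ := exists_code_encode F
    obtain rfl : G = encode cg := by omega
    have hs0 : s 0 = (encode (Code.prec cf cg) : ℕ) := by
      rw [encode_prec, h0, hz]
      push_cast
      rfl
    obtain ⟨c, b', i', e1', e2', e3', e4'⟩ := (hp 3).eval (by omega)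
    obtain rfl : c = Code.prec cf cg := encode_injective (by omega)
    obtain rfl : k' = k + 1 := by omega
    obtain rfl : a = a' := by omega
    obtain rfl : a = a₁ := by omega
    obtain rfl : k = k₁ := by omega
    obtain rfl : i = i' := by omega
    obtain rfl : z₁ = Nat.pair k i := by omega
    obtain rfl : b = Nat.pair a (Nat.pair k i) := by omega
    obtain rfl : b' = Nat.pair a k := by omega
    exact .inr ⟨.prec cf cg, Nat.pair a (k + 1), v, hs0, hx, by omega,
      mem_eval_prec_succ.2 ⟨i, e4', e4⟩⟩
  · obtain ⟨a, m, ha, hm, hx⟩ := h3.eq_pair (hp 0)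
    obtain ⟨cf, b, v, e1, e2, e3, e4⟩ := (hp 1).eval hf
    obtain rfl : b = Nat.pair a m := by omega
    obtain rfl : v = 0 := by omega
    refine .inr ⟨.rfind' cf, Nat.pair a m, m, ?_, hx, hm, mem_eval_rfind'_of_zero e4⟩
    rw [encode_rfind', h0, e1]
    push_cast
    rfl
  · obtain ⟨a, m, ha, hm, hx⟩ := h3.eq_pair (hp 0)
    obtain ⟨a', m', ha', hm', hx'⟩ := h4.eq_pair (hp 2)
    obtain ⟨cf, b, v, e1, e2, e3, e4⟩ := (hp 1).eval hf
    have hs0 : s 0 = (encode (Code.rfind' cf) : ℕ) := by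
      rw [encode_rfind', h0, e1]
      push_cast
      rfl
    obtain ⟨c, b', y, e1', e2', e3', e4'⟩ := (hp 3).eval (by omega)
    obtain rfl : c = Code.rfind' cf := encode_injective (by omega)
    obtain rfl : b = Nat.pair a m := by omega
    obtain rfl : a = a' := by omega
    obtain rfl : m' = m + 1 := by omega
    obtain rfl : b' = Nat.pair a (m + 1) := by omega
    exact .inr ⟨.rfind' cf, Nat.pair a m, y, hs0, hx, by omega,
      mem_eval_rfind'_of_succ e4 (by omega) e4'⟩

theorem IsAxiomFact.holds {s : Fact} (h : IsAxiomFact s) : s.Holds := by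
  rcases h with ⟨-, ⟨h0, h1, h2⟩ | ⟨h0, h1, h2⟩ | ⟨h0, h1, h2⟩⟩
  · exact .inl ⟨h0, 0, by simpa using h1, by simpa using h2⟩
  · exact .inr ⟨.zero, (s 1).toNat, 0, h0, by omega, h2, by simp [Code.eval, pure, PFun.pure]⟩
  · exact .inr ⟨.succ, (s 1).toNat, (s 1).toNat + 1, h0, by omega, by omega, by simp [Code.eval]⟩

theorem IsClosedUnder.holds {X : Set Fact} (hX : IsClosedUnder X) {s : Fact} (hs : s ∈ X) :
    s.Holds := by
  induction hm : (s 3).toNat using Nat.strong_induction_on generalizing s with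
  | _ m ih =>
    rcases hX s hs with h | ⟨p, u, ⟨hinf, hrank⟩, hp⟩
    · exact h.holds
    · refine hinf.holds fun j => ih _ ?_ (hp j) rfl
      have := hrank j
      omega

/-! ### Completeness of the rules -/

/-- The fact with its rank replaced by `t`. -/
def Fact.withRank (s : Fact) (t : ℤ) : Fact := ![s 0, s 1, s 2, t]

/-- With a suitable rank, the fact belongs to a finite closed set. -/
def Provable (s : Fact) : Prop :=
  ∃ X : Set Fact, X.Finite ∧ IsClosedUnder X ∧ ∃ t, 0 ≤ t ∧ s.withRank t ∈ X

theorem IsAxiomFact.provable {s : Fact} (h : IsAxiomFact s) : Provable s := by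
  refine ⟨{s.withRank 0}, Set.finite_singleton _, ?_, 0, le_rfl, rfl⟩
  rintro _ rfl
  exact .inl ⟨le_rfl, h.2⟩

/-- The union of the derivations of the premises, with the conclusion added at a rank above all of
theirs, is again finite and closed. -/
theorem Infers.provable {s : Fact} {p : Fin 7 → Fact} {u : Fin 6 → ℤ} (h : Infers s p u)
    (hp : ∀ j, Provable (p j)) : Provable s := by
  choose X hfin hcl t ht hmem using hp
  have hT : ∀ j, t j ≤ ∑ i, t i := fun j =>
    Finset.single_le_sum (fun i _ => ht i) (Finset.mem_univ j)
  refine ⟨insert (s.withRank (∑ i, t i + 1)) (⋃ j, X j), (Set.finite_iUnion hfin).insert _, ?_,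
    ∑ i, t i + 1, by have := Finset.sum_nonneg fun i (_ : i ∈ Finset.univ) => ht i; omega,
    Set.mem_insert _ _⟩
  rintro s' (rfl | hs')
  -- The rules ignore the fourth coordinate, so `h` still applies after the ranks are changed.
  · refine .inr ⟨fun j => (p j).withRank (t j), u, ⟨h, fun j => ⟨ht j, ?_⟩⟩, fun j =>
      Set.mem_insert_of_mem _ (Set.mem_iUnion.2 ⟨j, hmem j⟩)⟩
    exact Int.lt_add_one_of_le (hT j)
  · obtain ⟨j, hj⟩ := Set.mem_iUnion.1 hs'
    refine (hcl j s' hj).imp_right fun ⟨q, v, hq, hqX⟩ => ⟨q, v, hq, fun i =>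
      Set.mem_insert_of_mem _ (Set.mem_iUnion.2 ⟨j, hqX i⟩)⟩

/-- The fact that `a * a` is the square of `a`. -/
def sqFact (a : ℕ) : Fact := ![-1, a, a * a, 0]

/-- The fact that `v` is the value at `a` of the function coded by `c`. -/
def evalFact (c : Code) (a v : ℕ) : Fact := ![(encode c : ℕ), a, v, 0]

theorem provable_sqFact (a : ℕ) : Provable (sqFact a) := by
  induction a with
  | zero => exact IsAxiomFact.provable ⟨le_rfl, .inl ⟨rfl, rfl, rfl⟩⟩
  | succ a ih =>
    refine Infers.provable (p := fun _ => sqFact a) (u := 0) (.inl ⟨rfl, rfl, ?_, ?_⟩) fun _ => ih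
    · simp [sqFact]
    · simp [sqFact]
      ring

theorem isPair_sqFact (a b : ℕ) : IsPair (sqFact (max a b)) a b (Nat.pair a b) := by
  refine ⟨rfl, by positivity, by positivity, ?_⟩
  rcases lt_or_ge a b with h | h
  · refine .inl ⟨by omega, ?_, ?_⟩
    · simp [sqFact, max_eq_right h.le]
    · simp [sqFact, max_eq_right h.le, Nat.pair, h]
  · refine .inr ⟨by omega, ?_, ?_⟩
    · simp [sqFact, max_eq_left h]
    · simp [sqFact, max_eq_left h, Nat.pair, h.not_gt]

theorem forall_fin_seven {P : Fin 7 → Prop} (h0 : P 0) (h1 : P 1) (h2 : P 2) (h3 : P 3) (h4 : P 4)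
    (h5 : P 5) (h6 : P 6) : ∀ j, P j := by
  intro j
  fin_cases j <;> assumption

theorem provable_evalFact_prec {cf cg : Code}
    (hf : ∀ a v, v ∈ cf.eval a → Provable (evalFact cf a v))
    (hg : ∀ a v, v ∈ cg.eval a → Provable (evalFact cg a v)) (a k v : ℕ)
    (hv : v ∈ (Code.prec cf cg).eval (Nat.pair a k)) :
    Provable (evalFact (.prec cf cg) (Nat.pair a k) v) := by
  have hsq := provable_sqFact
  have henc : ((encode (Code.prec cf cg) : ℕ) : ℤ) =
      4 * (Nat.pair (encode cf) (encode cg) : ℕ) + 5 := by rw [encode_prec]; push_cast; rfl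
  induction k generalizing v with
  | zero =>
    rw [Code.eval_prec_zero] at hv
    -- Every rule takes seven provable premises; unused slots hold `sqFact 0`.
    refine Infers.provable (p := ![sqFact (max (encode cf) (encode cg)), sqFact (max a 0),
        evalFact cf a v, sqFact 0, sqFact 0, sqFact 0, sqFact 0])
      (u := ![(Nat.pair (encode cf) (encode cg) : ℕ), (encode cg : ℕ), 0, 0, 0, 0])
      (.inr <| .inr <| .inr <| .inr <| .inr <| .inl
        ⟨henc, isPair_sqFact _ _, isPair_sqFact _ _, rfl⟩)
      (forall_fin_seven (hsq _) (hsq _) (hf _ _ hv) (hsq _) (hsq _) (hsq _) (hsq _))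
  | succ k ih =>
    obtain ⟨i, hi, hv⟩ := mem_eval_prec_succ.1 hv
    refine Infers.provable (p := ![sqFact (max (encode cf) (encode cg)), sqFact (max a (k + 1)),
        sqFact (max a k), evalFact (.prec cf cg) (Nat.pair a k) i, sqFact (max k i),
        sqFact (max a (Nat.pair k i)), evalFact cg (Nat.pair a (Nat.pair k i)) v])
      (u := ![(Nat.pair (encode cf) (encode cg) : ℕ), (encode cf : ℕ), a, k, (Nat.pair k i : ℕ), 0])
      (.inr <| .inr <| .inr <| .inr <| .inr <| .inr <| .inl
        ⟨henc, isPair_sqFact _ _, isPair_sqFact _ _, isPair_sqFact _ _, rfl, isPair_sqFact _ _,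
          isPair_sqFact _ _, rfl⟩)
      (forall_fin_seven (hsq _) (hsq _) (hsq _) (ih _ hi) (hsq _) (hsq _) (hg _ _ hv))

theorem provable_evalFact_rfind' {cf : Code}
    (hf : ∀ a v, v ∈ cf.eval a → Provable (evalFact cf a v)) (a m v : ℕ)
    (hv : v ∈ (Code.rfind' cf).eval (Nat.pair a m)) :
    Provable (evalFact (.rfind' cf) (Nat.pair a m) v) := by
  have hsq := provable_sqFact
  have henc : ((encode (Code.rfind' cf) : ℕ) : ℤ) = 4 * (encode cf : ℕ) + 7 := by
    rw [encode_rfind']; push_cast; rfl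
  obtain ⟨n, rfl, h1, h2⟩ := mem_eval_rfind'.1 hv
  clear hv
  induction n generalizing m with
  | zero =>
    rw [Nat.zero_add] at h1 ⊢
    refine Infers.provable (p := ![sqFact (max a m), evalFact cf (Nat.pair a m) 0,
        sqFact 0, sqFact 0, sqFact 0, sqFact 0, sqFact 0])
      (u := ![0, 0, a, 0, 0, 0])
      (.inr <| .inr <| .inr <| .inr <| .inr <| .inr <| .inr <| .inl
        ⟨Int.natCast_nonneg _, henc, rfl, rfl, isPair_sqFact _ _⟩)
      (forall_fin_seven (hsq _) (hf _ _ h1) (hsq _) (hsq _) (hsq _) (hsq _) (hsq _))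
  | succ n ih =>
    obtain ⟨y, hy, hy0⟩ := h2 0 (by omega)
    rw [Nat.zero_add] at hy
    have hadd : ∀ j, j + 1 + m = j + (m + 1) := fun j => by ring
    have hrec := ih (m + 1) (by rwa [← hadd]) fun j hj => by
      rw [← hadd]
      exact h2 (j + 1) (by omega)
    rw [hadd]
    refine Infers.provable (p := ![sqFact (max a m), evalFact cf (Nat.pair a m) y,
        sqFact (max a (m + 1)), evalFact (.rfind' cf) (Nat.pair a (m + 1)) (n + (m + 1)),
        sqFact 0, sqFact 0, sqFact 0])
      (u := ![0, 0, a, m, 0, 0])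
      (.inr <| .inr <| .inr <| .inr <| .inr <| .inr <| .inr <| .inr
        ⟨Int.natCast_nonneg _, henc, rfl, ?_, isPair_sqFact _ _, isPair_sqFact _ _, rfl, rfl⟩)
      (forall_fin_seven (hsq _) (hf _ _ hy) (hsq _) hrec (hsq _) (hsq _) (hsq _))
    change (1 : ℤ) ≤ y
    omega

theorem provable_evalFact (c : Code) : ∀ a v : ℕ, v ∈ c.eval a → Provable (evalFact c a v) := by
  have hsq := provable_sqFact
  induction c with
  | zero =>
    intro a v hv
    obtain rfl : v = 0 := by simpa [Code.eval, pure, PFun.pure] using hv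
    exact IsAxiomFact.provable ⟨le_rfl, .inr <| .inl ⟨rfl, Int.natCast_nonneg _, rfl⟩⟩
  | succ =>
    intro a v hv
    obtain rfl : v = a + 1 := by simpa [Code.eval] using hv
    exact IsAxiomFact.provable ⟨le_rfl, .inr <| .inr ⟨rfl, Int.natCast_nonneg _, rfl⟩⟩
  | left =>
    intro a v hv
    obtain rfl : v = a.unpair.1 := by simpa [Code.eval] using hv
    refine Infers.provable (p := fun _ => sqFact (max a.unpair.1 a.unpair.2))
      (u := fun _ => a.unpair.2) (.inr <| .inl ⟨rfl, ?_⟩) fun _ => hsq _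
    simpa [evalFact] using isPair_sqFact a.unpair.1 a.unpair.2
  | right =>
    intro a v hv
    obtain rfl : v = a.unpair.2 := by simpa [Code.eval] using hv
    refine Infers.provable (p := fun _ => sqFact (max a.unpair.1 a.unpair.2))
      (u := fun _ => a.unpair.1) (.inr <| .inr <| .inl ⟨rfl, ?_⟩) fun _ => hsq _
    simpa [evalFact] using isPair_sqFact a.unpair.1 a.unpair.2
  | pair cf cg hf hg =>
    intro a v hv
    obtain ⟨x, hx, y, hy, rfl⟩ := mem_eval_pair.1 hv
    have henc : ((encode (Code.pair cf cg) : ℕ) : ℤ) =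
      4 * (Nat.pair (encode cf) (encode cg) : ℕ) + 4 := by rw [encode_pair]; push_cast; rfl
    exact Infers.provable (p := ![sqFact (max (encode cf) (encode cg)), evalFact cf a x,
        evalFact cg a y, sqFact (max x y), sqFact 0, sqFact 0, sqFact 0])
      (u := fun _ => (Nat.pair (encode cf) (encode cg) : ℕ))
      (.inr <| .inr <| .inr <| .inl ⟨henc, isPair_sqFact _ _, rfl, rfl, isPair_sqFact _ _⟩)
      (forall_fin_seven (hsq _) (hf _ _ hx) (hg _ _ hy) (hsq _) (hsq _) (hsq _) (hsq _))
  | comp cf cg hf hg =>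
    intro a v hv
    obtain ⟨x, hx, hv⟩ := mem_eval_comp.1 hv
    have henc : ((encode (Code.comp cf cg) : ℕ) : ℤ) =
      4 * (Nat.pair (encode cf) (encode cg) : ℕ) + 6 := by rw [encode_comp]; push_cast; rfl
    exact Infers.provable (p := ![sqFact (max (encode cf) (encode cg)), evalFact cf x v,
        evalFact cg a x, sqFact 0, sqFact 0, sqFact 0, sqFact 0])
      (u := fun _ => (Nat.pair (encode cf) (encode cg) : ℕ))
      (.inr <| .inr <| .inr <| .inr <| .inl ⟨henc, isPair_sqFact _ _, rfl, rfl, rfl⟩)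
      (forall_fin_seven (hsq _) (hf _ _ hv) (hg _ _ hx) (hsq _) (hsq _) (hsq _) (hsq _))
  | prec cf cg hf hg =>
    intro a v hv
    rw [← Nat.pair_unpair a] at hv ⊢
    exact provable_evalFact_prec hf hg _ _ v hv
  | rfind' cf hf =>
    intro a v hv
    rw [← Nat.pair_unpair a] at hv ⊢
    exact provable_evalFact_rfind' hf _ _ v hv

end SinPA

/-! ### The reduction from the halting problem. -/

namespace SinPA

open Nat.Partrec Encodable

/-! ### The matrix of the sentences -/

/-- The first four entries of a row. -/
def fact (r : Fin 6 → ℤ) : Fact := fun j => r (Fin.castLE (by norm_num) j)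

/-- With the code in the block `P`, the row `s` lists a vector, together with integers `b` and `n`
that are not refuted by the row `w` as witnesses of the vector being marked. -/
def Unrefuted (P : Block) (s w : Fin 6 → ℤ) : Prop :=
  (∀ j, |fact s j| ≤ |P 2 0|) ∧ |s 4| < |s 5| ∧ |s 5| ≤ |P 2 1| ∧
    (|w 5| ≤ |s 4| → Real.sin (P 0 5 - w 5) < Real.sin (P 0 5 - s 5)) ∧
    ((∀ j, |fact w j| ≤ |P 2 0|) → |w 4| ≤ |s 5| →
      score (fun j => (fact (P 0) j : ℝ)) (P 0 4) (fact w) (w 4) ≤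
        score (fun j => (fact (P 0) j : ℝ)) (P 0 4) (fact s) (s 4))

/-- The set of facts coded by the block `P`. -/
def coded (P : Block) : Set Fact :=
  {s | Marked (fun j => (fact (P 0) j : ℝ)) (P 0 4) (P 0 5) (P 2 0) (P 2 1) s}

/-- The row of a premise in its block. -/
def premiseRow (j : Fin 7) : Fin 11 := ⟨j + 1, by omega⟩

/-- The four blocks say that a halting fact for the code `n` is coded by the first block, and that
every fact coded there is an axiom or follows from other such facts. -/
def matrix (n : ℕ) (v : Fin 4 → Block) : Prop :=
  v 0 1 0 = n ∧ v 0 1 1 = 0 ∧ Unrefuted (v 0) (v 0 1) (v 1 0) ∧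
    (Unrefuted (v 0) (v 1 1) (v 2 0) → IsAxiomFact (fact (v 1 1)) ∨
      RankedInfers (fact (v 1 1)) (fun j => fact (v 2 (premiseRow j))) (v 2 8) ∧
        ∀ j, Unrefuted (v 0) (v 2 (premiseRow j)) (v 3 0))

/-! ### The meaning of the sentences -/

theorem exists_row (s : Fact) (b n : ℤ) : ∃ r : Fin 6 → ℤ, fact r = s ∧ r 4 = b ∧ r 5 = n := by
  refine ⟨![s 0, s 1, s 2, s 3, b, n], funext fun j => ?_, rfl, rfl⟩
  fin_cases j <;> rfl

/-- One row `w` serves both universal conditions of `Marked`: its last entry is the rival of `n`,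
the others are the rival of `(s, b)`. -/
theorem mem_coded_of_forall {P : Block} {s : Fin 6 → ℤ} (h : ∀ w, Unrefuted P s w) :
    fact s ∈ coded P := by
  refine ⟨(h 0).1, s 4, s 5, (h 0).2.1, (h 0).2.2.1, fun y hy => ?_, fun w b' hw hb' => ?_⟩
  · obtain ⟨r, -, -, rfl⟩ := exists_row 0 0 y
    exact (h r).2.2.2.1 hy
  · obtain ⟨r, rfl, rfl, -⟩ := exists_row w b' 0
    exact (h r).2.2.2.2 hw hb'

theorem exists_forall_unrefuted {P : Block} {s : Fact} (h : s ∈ coded P) :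
    ∃ r, fact r = s ∧ ∀ w, Unrefuted P r w := by
  obtain ⟨hbox, b, n, h1, h2, h3, h4⟩ := h
  obtain ⟨r, rfl, rfl, rfl⟩ := exists_row s b n
  exact ⟨r, rfl, fun w => ⟨hbox, h1, h2, h3 _, h4 _ _⟩⟩

theorem dom_of_matrix {c : Code}
    (h : ∃ v₁, ∀ v₂, ∃ v₃, ∀ v₄, matrix (encode c) ![v₁, v₂, v₃, v₄]) : (c.eval 0).Dom := by
  obtain ⟨v₁, h⟩ := h
  have hgoal : fact (v₁ 1) ∈ coded v₁ := by
    refine mem_coded_of_forall fun w => ?_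
    obtain ⟨v₃, h⟩ := h fun _ => w
    exact (h 0).2.2.1
  have hcl : IsClosedUnder (coded v₁) := by
    intro s hs
    obtain ⟨r, rfl, hr⟩ := exists_forall_unrefuted hs
    obtain ⟨v₃, h⟩ := h fun _ => r
    rcases (h 0).2.2.2 (hr _) with hax | ⟨hinf, -⟩
    · exact .inl hax
    -- Which disjunct holds could vary with the fourth block, but being an axiom does not depend on
    -- it. If it fails, the premises are unrefuted for every fourth block.
    · by_cases hax : IsAxiomFact (fact r)
      · exact .inl hax
      · refine .inr ⟨_, _, hinf, fun j => mem_coded_of_forall fun w => ?_⟩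
        exact (((h fun _ => w).2.2.2 (hr _)).resolve_left hax).2 j
  obtain ⟨v₃, h⟩ := h 0
  obtain ⟨h0, h1, -⟩ := h 0
  replace h0 : fact (v₁ 1) 0 = (encode c : ℕ) := h0
  replace h1 : fact (v₁ 1) 1 = 0 := h1
  obtain ⟨c', a, v, e0, e1, -, hv⟩ := (hcl.holds hgoal).eval (by omega)
  obtain rfl : c' = c := encode_injective (by omega)
  obtain rfl : a = 0 := by omega
  exact Part.dom_iff_mem.2 ⟨v, hv⟩

theorem exists_block_coded {X : Set Fact} (hX : X.Finite) :
    ∃ P : Block, coded P = X := by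
  obtain ⟨S, hS⟩ : ∃ S : ℤ, ∀ s ∈ X, ∀ j, |s j| ≤ |S| := by
    refine ⟨∑ s ∈ hX.toFinset, ∑ j, |s j|, fun s hs j => ?_⟩
    refine le_trans ?_ (le_abs_self _)
    refine le_trans (Finset.single_le_sum (fun i _ => abs_nonneg (s i)) (Finset.mem_univ j)) ?_
    exact Finset.single_le_sum (f := fun s : Fact => ∑ j, |s j|)
      (fun s _ => Finset.sum_nonneg fun i _ => abs_nonneg (s i)) (hX.mem_toFinset.2 hs)
  obtain ⟨Θ, C, C', N, h⟩ := exists_code S hX.toFinset.toList (by simpa using hS)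
  obtain ⟨r, rfl, rfl, rfl⟩ := exists_row Θ C C'
  refine ⟨![r, 0, ![S, N, 0, 0, 0, 0], 0, 0, 0, 0, 0, 0, 0, 0], Set.ext fun s => ?_⟩
  have := h s
  rw [Finset.mem_toList, hX.mem_toFinset] at this
  exact this

theorem matrix_of_dom {c : Code} (h : (c.eval 0).Dom) :
    ∃ v₁, ∀ v₂, ∃ v₃, ∀ v₄, matrix (encode c) ![v₁, v₂, v₃, v₄] := by
  obtain ⟨y, hy⟩ := Part.dom_iff_mem.1 h
  obtain ⟨X, hfin, hcl, t, -, hmem⟩ := provable_evalFact c 0 y hy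
  obtain ⟨P, rfl⟩ := exists_block_coded hfin
  obtain ⟨g, hg, hgP⟩ := exists_forall_unrefuted hmem
  -- Row 1 is not part of the code, so it is free to hold the goal with its witnesses.
  refine ⟨Function.update P 1 g, fun v₂ => ?_⟩
  by_cases hs : ∀ w, Unrefuted P (v₂ 1) w
  · rcases hcl _ (mem_coded_of_forall hs) with hax | ⟨p, u, hinf, hp⟩
    · exact ⟨0, fun v₄ => ⟨congrFun hg 0, congrFun hg 1, hgP _, fun _ => .inl hax⟩⟩
    · choose r hr hrP using fun j => exists_forall_unrefuted (hp j)
      obtain rfl : p = fun j => fact (r j) := funext fun j => (hr j).symm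
      obtain ⟨v₃, hv₃, rfl⟩ : ∃ v₃ : Block, (∀ j, v₃ (premiseRow j) = r j) ∧ v₃ 8 = u :=
        ⟨![0, r 0, r 1, r 2, r 3, r 4, r 5, r 6, u, 0, 0], fun j => by fin_cases j <;> rfl, rfl⟩
      simp only [← hv₃] at hinf hrP
      exact ⟨v₃, fun v₄ => ⟨congrFun hg 0, congrFun hg 1, hgP _, fun _ =>
        .inr ⟨hinf, fun j => hrP j _⟩⟩⟩
  -- The candidate's witnesses are wrong; the third block supplies a row refuting them, which makes
  -- the implication vacuous.
  · push Not at hs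
    obtain ⟨w, hw⟩ := hs
    exact ⟨fun _ => w, fun v₄ => ⟨congrFun hg 0, congrFun hg 1, hgP _, fun h => absurd h hw⟩⟩

/-! ### Definability of the matrix -/

theorem isIntTerm_fact (a : Fin 4) (i : Fin 11) (j : Fin 4) :
    IsIntTerm fun _ v => fact (v a i) j := .var _ _ _

theorem isQFForm_isPair {q : ℕ → (Fin 4 → Block) → Fact} {a b z : ℕ → (Fin 4 → Block) → ℤ}
    (hq : ∀ j, IsIntTerm fun n v => q n v j) (ha : IsIntTerm a) (hb : IsIntTerm b)
    (hz : IsIntTerm z) : IsQFForm fun n v => IsPair (q n v) (a n v) (b n v) (z n v) :=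
  ((hq 0).eq (.const _)).and <| ((IsIntTerm.const 0).le ha).and <| ((IsIntTerm.const 0).le hb).and
    (((ha.lt hb).and <| ((hq 1).eq hb).and (hz.eq ((hq 2).add ha))).or
      ((hb.le ha).and <| ((hq 1).eq ha).and (hz.eq (((hq 2).add ha).add hb))))

theorem isQFForm_isAxiomFact {s : ℕ → (Fin 4 → Block) → Fact}
    (hs : ∀ j, IsIntTerm fun n v => s n v j) : IsQFForm fun n v => IsAxiomFact (s n v) := by
  have hc := IsIntTerm.const
  exact ((hc 0).le (hs 3)).and <|
    (((hs 0).eq (hc _)).and <| ((hs 1).eq (hc _)).and ((hs 2).eq (hc _))).or <|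
    (((hs 0).eq (hc _)).and <| ((hc _).le (hs 1)).and ((hs 2).eq (hc _))).or
    (((hs 0).eq (hc _)).and <| ((hc _).le (hs 1)).and ((hs 2).eq ((hs 1).add (hc _))))

theorem isQFForm_rankedInfers {s : ℕ → (Fin 4 → Block) → Fact}
    {p : ℕ → (Fin 4 → Block) → Fin 7 → Fact} {u : ℕ → (Fin 4 → Block) → Fin 6 → ℤ}
    (hs : ∀ j, IsIntTerm fun n v => s n v j) (hp : ∀ i j, IsIntTerm fun n v => p n v i j)
    (hu : ∀ j, IsIntTerm fun n v => u n v j) :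
    IsQFForm fun n v => RankedInfers (s n v) (p n v) (u n v) := by
  have hc := IsIntTerm.const
  have hpair {i a b z} (ha : IsIntTerm a) (hb : IsIntTerm b) (hz : IsIntTerm z) :
    IsQFForm fun n v => IsPair (p n v i) (a n v) (b n v) (z n v) := isQFForm_isPair (hp i) ha hb hz
  refine IsQFForm.and ?_ (.forall_fin fun j => ((hc 0).le (hp j 3)).and ((hp j 3).lt (hs 3)))
  have hcode (k : ℤ) : IsQFForm fun n v => s n v 0 = 4 * u n v 0 + k :=
    (hs 0).eq (((hu 0).mul 4).add (hc k))
  have hrfind : IsQFForm fun n v => s n v 0 = 4 * p n v 1 0 + 7 :=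
    (hs 0).eq (((hp 1 0).mul 4).add (hc 7))
  exact (((hs 0).eq (hc _)).and <| ((hp 0 0).eq (hc _)).and <|
      ((hp 0 1).eq ((hs 1).sub (hc 1))).and
        ((hp 0 2).eq (((hs 2).sub ((hs 1).mul 2)).add (hc 1)))).or <|
    (((hs 0).eq (hc _)).and (hpair (hs 2) (hu 0) (hs 1))).or <|
    (((hs 0).eq (hc _)).and (hpair (hu 0) (hs 2) (hs 1))).or <|
    ((hcode 4).and <| (hpair (hp 1 0) (hp 2 0) (hu 0)).and <| ((hp 1 1).eq (hs 1)).and <|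
      ((hp 2 1).eq (hs 1)).and (hpair (hp 1 2) (hp 2 2) (hs 2))).or <|
    ((hcode 6).and <| (hpair (hp 1 0) (hp 2 0) (hu 0)).and <| ((hp 2 1).eq (hs 1)).and <|
      ((hp 1 1).eq (hp 2 2)).and ((hp 1 2).eq (hs 2))).or <|
    ((hcode 5).and <| (hpair (hp 2 0) (hu 1) (hu 0)).and <|
      (hpair (hp 2 1) (hc 0) (hs 1)).and ((hp 2 2).eq (hs 2))).or <|
    ((hcode 5).and <| (hpair (hu 1) (hp 6 0) (hu 0)).and <|
      (hpair (hu 2) ((hu 3).add (hc 1)) (hs 1)).and <| (hpair (hu 2) (hu 3) (hp 3 1)).and <|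
      ((hp 3 0).eq (hs 0)).and <| (hpair (hu 3) (hp 3 2) (hu 4)).and <|
      (hpair (hu 2) (hu 4) (hp 6 1)).and ((hp 6 2).eq (hs 2))).or <|
    (((hc 0).le (hp 1 0)).and <| hrfind.and <| ((hp 1 1).eq (hs 1)).and <|
      ((hp 1 2).eq (hc 0)).and (hpair (hu 2) (hs 2) (hs 1))).or
    (((hc 0).le (hp 1 0)).and <| hrfind.and <| ((hp 1 1).eq (hs 1)).and <|
      ((hc 1).le (hp 1 2)).and <| (hpair (hu 2) (hu 3) (hs 1)).and <|
      (hpair (hu 2) ((hu 3).add (hc 1)) (hp 3 1)).and <|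
      ((hp 3 0).eq (hs 0)).and ((hp 3 2).eq (hs 2)))

/-- The phase is a fixed sum of four sines, so the score is a term with nested sines and no products
of variables. -/
theorem isTerm_score (a a' : Fin 4) (i i' : Fin 11) :
    IsTerm fun _ v => score (fun j => (fact (v a i) j : ℝ)) (v a i 4) (fact (v a' i'))
      (v a' i' 4) := by
  have hsin (j : Fin 4) : IsTerm fun _ v =>
      Real.sin ((fact (v a' i') j : ℝ) + (fact (v a i) j : ℝ)) :=
    (IsTerm.add (isIntTerm_fact a' i' j) (isIntTerm_fact a i j)).sin
  refine IsTerm.sin (IsTerm.sub (IsTerm.sub (IsIntTerm.var a i 4) (IsIntTerm.var a' i' 4)) ?_)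
  exact ((((hsin 0).add (hsin 1)).add (hsin 2)).add (hsin 3)).congr fun n v => by
    rw [phase, Fin.sum_univ_four]

theorem isQFForm_unrefuted (a a' : Fin 4) (i i' : Fin 11) :
    IsQFForm fun _ v => Unrefuted (v 0) (v a i) (v a' i') := by
  have hv := IsIntTerm.var
  have hbox (a i) : IsQFForm fun _ v => ∀ j, |fact (v a i) j| ≤ |v 0 2 0| :=
    .forall_fin fun j => (isIntTerm_fact a i j).abs_le_abs (hv 0 2 0)
  exact (hbox a i).and <| ((hv a i 4).abs_lt_abs (hv a i 5)).and <|
    ((hv a i 5).abs_le_abs (hv 0 2 1)).and <|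
    (((hv a' i' 5).abs_le_abs (hv a i 4)).imp
      ((((hv 0 0 5).cast.sub (hv a' i' 5).cast).sin).lt
        (((hv 0 0 5).cast.sub (hv a i 5).cast).sin))).and
    ((hbox a' i').imp (((hv a' i' 4).abs_le_abs (hv a i 5)).imp
      ((isTerm_score 0 a' 0 i').le (isTerm_score 0 a 0 i))))

theorem isQFForm_matrix : IsQFForm matrix :=
  ((IsIntTerm.var 0 1 0).eq .param).and <| ((IsIntTerm.var 0 1 1).eq (.const 0)).and <|
    (isQFForm_unrefuted 0 1 1 0).and <| (isQFForm_unrefuted 1 2 1 0).imp <|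
    (isQFForm_isAxiomFact (isIntTerm_fact 1 1)).or <|
    (isQFForm_rankedInfers (isIntTerm_fact 1 1) (fun j => isIntTerm_fact 2 (premiseRow j))
      (IsIntTerm.var 2 8)).and
    (.forall_fin fun j => isQFForm_unrefuted 2 3 (premiseRow j) 0)

end SinPA

/-- The set of true `∃^K ∀^K ∃^K ∀^K` sine-Presburger sentences with `K = 3388` is undecidable. -/
theorem theoremA :
    ¬ SinPA.DecidableSet {Φ : SinPA.Form 0 | SinPA.IsEAEA 3388 Φ ∧ SinPA.IsTrue Φ} := by
  intro hdec
  obtain ⟨Φ, hcode, hΦ⟩ := SinPA.isQFForm_matrix.exists_sentences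
  refine ComputablePred.halting_problem 0 (ComputablePred.computable_of_manyOneReducible
    ⟨fun c => (Φ (Encodable.encode c)).code, hcode.comp Computable.encode, fun c => ?_⟩ hdec)
  constructor
  · intro h
    exact ⟨_, ⟨(hΦ _).1, (hΦ _).2.2 (SinPA.matrix_of_dom h)⟩, rfl⟩
  · rintro ⟨Ψ, ⟨-, hΨ⟩, heq⟩
    obtain rfl := SinPA.Form.code_injective heq
    exact SinPA.dom_of_matrix ((hΦ _).2.1 hΨ)
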